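/- For $k_1,\dots,k_d\in\mathbb N=\{1,2,\dots\}$ and roots of unity $x_1,\dots,x_d$ with $(k_d,x_d)\neq(1,1)$, define the cyclotomic multiple zeta value and the cyclotomic multiple $S$-value of depth $d\ge 1$ by $$\mathrm{Li}_{k_1,\dots,k_d}(x_1,\dots,x_d)=\sum_{0<n_1<\cdots<n_d}\frac{x_1^{n_1}\cdots x_d^{n_d}}{n_1^{k_1}\cdots n_d^{k_d}},\qquad S_{k_1,\dots,k_d}(x_1,\dots,x_d)=2^d\sum_{0<n_1<\cdots<n_d}\frac{x_1^{n_1}x_2^{n_2}\cdots x_d^{n_d}}{(2n_1)^{k_1}(2n_2-1)^{k_2}\cdots(2n_d-d+1)^{k_d}},$$ the sums being understood as limits, as $M\to\infty$, of the finite sums over $n_d\le M$. Let $x,y,z$ be roots of unity and let $p,q,r\ge 1$ be integers with $(p,x),(q,y),(r,z)\neq(1,1)$. Let $w$ be a square root of $y$, $w^2=y$. Then the series defining $S_{p,q,r}(x,y,z)$ and $S_{p,q,r}(x^{-1},y^{-1},z^{-1})$ converge, and $$S_{p,q,r}(x,y,z)+(-1)^{p+q+r}\,y z^2\,S_{p,q,r}\big(x^{-1},y^{-1},z^{-1}\big)=z\,w\,P,$$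 where $P$ is a $\mathbb Q$-linear combination of (nonempty finite) products whose factors are cyclotomic multiple $S$-values of depth $\le 2$ and cyclotomic multiple zeta values of depth $\le 2$ (of arbitrary levels). -/

import Mathlib

open Filter Topology

/-- The index tuples `0 < n₁ < n₂ < ⋯ < n_r ≤ M`. -/
noncomputable def increasingTuples (r M : ℕ) : Finset (Fin r → ℕ) :=
  open Classical in
  (Fintype.piFinset fun _ : Fin r => Finset.Icc 1 M).filter fun n => StrictMono n

/-- The part `n_r ≤ M` of the series of the cyclotomic multiple zeta value `Li_{k₁,…,k_r}(x₁,…,x_r)`. -/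
noncomputable def multipleZetaPartial {r : ℕ} (k : Fin r → ℕ) (x : Fin r → ℂ) (M : ℕ) : ℂ :=
  ∑ n ∈ increasingTuples r M, ∏ i, x i ^ n i / (n i : ℂ) ^ k i

/-- The part `n_r ≤ M` of the series of the cyclotomic multiple `S`-value `S_{k₁,…,k_r}(x₁,…,x_r)`.
Since `i : Fin r` counts from `0`, the denominators are `2 n₁, 2 n₂ - 1, …, 2 n_r - (r - 1)`;
the subtraction is in `ℂ`. -/
noncomputable def multipleSPartial {r : ℕ} (k : Fin r → ℕ) (x : Fin r → ℂ) (M : ℕ) : ℂ :=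
  2 ^ r * ∑ n ∈ increasingTuples r M,
    ∏ i, x i ^ n i / (2 * (n i : ℂ) - ((i : ℕ) : ℂ)) ^ k i

/-- The cyclotomic multiple zeta value
`Li_{k₁,…,k_r}(x₁,…,x_r) = ∑_{0 < n₁ < ⋯ < n_r} ∏ xᵢ ^ nᵢ / nᵢ ^ kᵢ`
(the series may converge only conditionally). -/
noncomputable def multipleZeta {r : ℕ} (k : Fin r → ℕ) (x : Fin r → ℂ) : ℂ :=
  limUnder atTop (multipleZetaPartial k x)

/-- The cyclotomic multiple `S`-value
`S_{k₁,…,k_r}(x₁,…,x_r) = 2 ^ r ∑_{0 < n₁ < ⋯ < n_r} ∏ xᵢ ^ nᵢ / (2 nᵢ - i + 1) ^ kᵢ`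
(the series may converge only conditionally). -/
noncomputable def multipleS {r : ℕ} (k : Fin r → ℕ) (x : Fin r → ℂ) : ℂ :=
  limUnder atTop (multipleSPartial k x)

/-- Admissible data of depth `r + 1`: positive exponents, arguments that are roots of unity, and
the last pair (exponent, argument) different from `(1, 1)`. -/
def IsAdmissible {r : ℕ} (k : Fin (r + 1) → ℕ) (x : Fin (r + 1) → ℂ) : Prop :=
  (∀ i, 1 ≤ k i) ∧ (∀ i, IsOfFinOrder (x i)) ∧ (k (Fin.last r), x (Fin.last r)) ≠ (1, 1)

/-- The set of all cyclotomic multiple zeta values of depth between `1` and `d`. -/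
def zetaValuesOfDepthLE (d : ℕ) : Set ℂ :=
  {v | ∃ (r : ℕ) (k : Fin (r + 1) → ℕ) (x : Fin (r + 1) → ℂ),
    r + 1 ≤ d ∧ IsAdmissible k x ∧ v = multipleZeta k x}

/-- The set of all cyclotomic multiple `S`-values of depth between `1` and `d`. -/
def sValuesOfDepthLE (d : ℕ) : Set ℂ :=
  {v | ∃ (r : ℕ) (k : Fin (r + 1) → ℕ) (x : Fin (r + 1) → ℂ),
    r + 1 ≤ d ∧ IsAdmissible k x ∧ v = multipleS k x}

/-- The `ℚ`-linear combinations of (nonempty finite) products of cyclotomic multiple `S`-values and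
cyclotomic multiple zeta values, each factor being of depth at most `d`. -/
noncomputable def rationalCombinationsOfProducts (d : ℕ) : Submodule ℚ ℂ :=
  Submodule.span ℚ
    (Subsemigroup.closure (sValuesOfDepthLE d ∪ zetaValuesOfDepthLE d) : Set ℂ)

/-! Choose square roots u, w, v of x, y, z. The integers 2n₁, 2n₂-1, 2n₃-2 are even, odd, even, and
they increase strictly exactly when n₁ < n₂ < n₃. So, up to the factor zw, the S-value is a triple
zeta sum in u, w, v with a parity condition on each index (`multipleSPartial_eq_psum`). Combining
the signs ±u, ±w, ±v removes these conditions (`parity_even_odd_even_mem`), and what remains is the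
parity theorem for zeta values of depth three, `parity_series_mem`: a nested triple series plus its
reflection under n ↦ -n reduces to depth ≤ 2. Reflection inverts the arguments and produces the sign
(-1)^(p+q+r).

For the parity theorem, sum z^m/m^r · x^(k-m)/(k-m)^p · y^(l-m)/(l-m)^q over k, l ≥ 1 and all
integers m, reading 1/0 as 0, in two ways. With m innermost, partial fractions in m reduce the inner
sum to bilateral sums of ζ^n/n^j, which are constants of depth one, minus the values at the excluded
points; only double sums over k, l of depth ≤ 2 survive (`exists_tendsto_window_sum`). With k and l
innermost, each sum is a full sum of depth one plus or minus a finite partial sum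
(`tendsto_psum_of_window`). Expanding the product leaves, modulo depth ≤ 2, a sum of products of two
partial sums (`cross_series_mem`). Inverting x and y aligns the signs of the indices
(`product_series_mem`), and the stuffle product turns products of partial sums into nested sums.

The series may converge only conditionally, so tails are recorded as O(1/n). This rate makes the
errors in the exchange of limits convolutions of two O(1/n) sequences, or O(1/N) outright. -/

/-! ### Series with tails of order 1/n. -/

/-- The sum of the first `n` values of `f`. -/
noncomputable def psum (f : ℕ → ℂ) (n : ℕ) : ℂ := ∑ a ∈ Finset.range n, f a

/-- The sequence `u` converges to `L` with error `O(1 / n)`. -/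
def RapidTo (u : ℕ → ℂ) (L : ℂ) : Prop := ∃ C : ℝ, ∀ n : ℕ, ‖u n - L‖ ≤ C / (n + 1)

/-- The series `∑ f n` converges to `L` with tails of size `O(1 / n)`. -/
def TameSum (f : ℕ → ℂ) (L : ℂ) : Prop := RapidTo (psum f) L

lemma psum_zero (f : ℕ → ℂ) : psum f 0 = 0 := by simp [psum]

lemma psum_succ (f : ℕ → ℂ) (n : ℕ) : psum f (n + 1) = psum f n + f n := by
  simp [psum, Finset.sum_range_succ]

lemma psum_add (f g : ℕ → ℂ) (n : ℕ) : psum (f + g) n = psum f n + psum g n := by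
  simp [psum, Finset.sum_add_distrib]

lemma psum_mul_left (c : ℂ) (f : ℕ → ℂ) (n : ℕ) : psum (fun a => c * f a) n = c * psum f n := by
  simp [psum, Finset.mul_sum]

/-- The stuffle product: pairs of indices are split by which one is larger, or equal. -/
lemma psum_mul_psum (f g : ℕ → ℂ) (n : ℕ) :
    psum f n * psum g n = psum (f * psum g + g * psum f + f * g) n := by
  induction n with
  | zero => simp [psum_zero]
  | succ n ih =>
    rw [psum_succ, psum_succ, psum_succ, ← ih]
    simp only [Pi.add_apply, Pi.mul_apply]
    ring

namespace RapidTo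

variable {u v : ℕ → ℂ} {L K : ℂ}

lemma exists_pos (h : RapidTo u L) : ∃ C : ℝ, 0 ≤ C ∧ ∀ n : ℕ, ‖u n - L‖ ≤ C / (n + 1) := by
  obtain ⟨C, hC⟩ := h
  refine ⟨C, ?_, hC⟩
  have := (norm_nonneg _).trans (hC 0)
  simpa using this

lemma tendsto (h : RapidTo u L) : Tendsto u atTop (𝓝 L) := by
  obtain ⟨C, hC⟩ := h
  rw [tendsto_iff_norm_sub_tendsto_zero]
  refine squeeze_zero (fun _ => norm_nonneg _) hC ?_
  have := (tendsto_one_div_add_atTop_nhds_zero_nat (𝕜 := ℝ)).const_mul C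
  simpa [div_eq_mul_inv] using this

lemma exists_norm_le (h : RapidTo u L) : ∃ C : ℝ, 0 ≤ C ∧ ∀ n : ℕ, ‖u n‖ ≤ C := by
  obtain ⟨C, hC0, hC⟩ := h.exists_pos
  refine ⟨C + ‖L‖, by positivity, fun n => ?_⟩
  have h1 : C / ((n : ℝ) + 1) ≤ C := div_le_self hC0 (by linarith [n.cast_nonneg (α := ℝ)])
  calc ‖u n‖ = ‖(u n - L) + L‖ := by simp
    _ ≤ ‖u n - L‖ + ‖L‖ := norm_add_le _ _
    _ ≤ C + ‖L‖ := by linarith [hC n]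

lemma const (c : ℂ) : RapidTo (fun _ => c) c := ⟨0, fun n => by simp⟩

lemma add (h : RapidTo u L) (h' : RapidTo v K) : RapidTo (u + v) (L + K) := by
  obtain ⟨C, hC⟩ := h
  obtain ⟨D, hD⟩ := h'
  refine ⟨C + D, fun n => ?_⟩
  rw [add_div, Pi.add_apply, add_sub_add_comm]
  exact (norm_add_le _ _).trans (add_le_add (hC n) (hD n))

lemma mul (h : RapidTo u L) (h' : RapidTo v K) : RapidTo (u * v) (L * K) := by
  obtain ⟨B, hB0, hB⟩ := h'.exists_norm_le
  obtain ⟨C, hC⟩ := h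
  obtain ⟨D, hD⟩ := h'
  refine ⟨C * B + ‖L‖ * D, fun n => ?_⟩
  have : (u * v) n - L * K = (u n - L) * v n + L * (v n - K) := by
    simp only [Pi.mul_apply]; ring
  rw [this, add_div]
  refine (norm_add_le _ _).trans (add_le_add ?_ ?_)
  · rw [norm_mul, mul_div_right_comm]
    exact mul_le_mul (hC n) (hB n) (norm_nonneg _) ((norm_nonneg _).trans (hC n))
  · rw [norm_mul, mul_div_assoc]
    exact mul_le_mul_of_nonneg_left (hD n) (norm_nonneg _)

lemma const_mul (c : ℂ) (h : RapidTo u L) : RapidTo (fun n => c * u n) (c * L) :=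
  (const c).mul h

lemma shift (h : RapidTo u L) : RapidTo (fun n => u (n + 1)) L := by
  obtain ⟨C, hC0, hC⟩ := h.exists_pos
  refine ⟨C, fun n => (hC (n + 1)).trans ?_⟩
  push_cast
  gcongr
  linarith

end RapidTo

namespace TameSum

variable {f g : ℕ → ℂ} {L K : ℂ}

lemma tendsto (h : TameSum f L) : Tendsto (psum f) atTop (𝓝 L) := RapidTo.tendsto h

lemma unique (h : TameSum f L) (h' : TameSum f K) : L = K :=
  tendsto_nhds_unique h.tendsto h'.tendsto

lemma add (h : TameSum f L) (h' : TameSum g K) : TameSum (f + g) (L + K) := by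
  have := RapidTo.add h h'
  rwa [show psum f + psum g = psum (f + g) from funext fun n => (psum_add f g n).symm] at this

lemma const_mul (c : ℂ) (h : TameSum f L) : TameSum (fun n => c * f n) (c * L) := by
  have := RapidTo.const_mul c h
  simp_rw [← psum_mul_left] at this
  exact this

lemma exists_norm_le (h : TameSum f L) : ∃ C : ℝ, 0 ≤ C ∧ ∀ n : ℕ, ‖f n‖ ≤ C / (n + 1) := by
  obtain ⟨C, hC0, hC⟩ := RapidTo.exists_pos h
  refine ⟨2 * C, by positivity, fun n => ?_⟩
  have h1 : f n = (psum f (n + 1) - L) - (psum f n - L) := by rw [psum_succ]; ring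
  have h2 : C / (((n + 1 : ℕ) : ℝ) + 1) ≤ C / ((n : ℝ) + 1) := by
    push_cast; gcongr; linarith
  rw [h1]
  calc _ ≤ ‖psum f (n + 1) - L‖ + ‖psum f n - L‖ := norm_sub_le _ _
    _ ≤ C / (n + 1) + C / (n + 1) := add_le_add ((hC _).trans h2) (hC n)
    _ = 2 * C / (n + 1) := by ring

lemma of_norm_le {C : ℝ} (hf : ∀ n : ℕ, ‖f n‖ ≤ C / (n + 1) ^ 2) : ∃ L, TameSum f L := by
  have hC0 : 0 ≤ C := by simpa using (norm_nonneg _).trans (hf 0)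
  have key : ∀ n d : ℕ, ‖psum f (n + d) - psum f n‖
      ≤ 2 * C / (n + 1) - 2 * C / (n + d + 1) := by
    intro n d
    induction d with
    | zero => simp
    | succ d ih =>
      -- A telescoping majorant; it yields both the Cauchy property and the O(1/n) tail.
      have hstep : C / ((n : ℝ) + d + 1) ^ 2
          ≤ 2 * C / (n + d + 1) - 2 * C / (n + d + 1 + 1) := by
        have h0 : (0 : ℝ) ≤ n + d := by positivity
        generalize (n : ℝ) + d = t at h0 ⊢
        rw [div_sub_div _ _ (by positivity) (by positivity), div_le_div_iff₀ (by positivity)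
          (by positivity)]
        have : 0 ≤ C * (t + 1) ^ 2 * t := by positivity
        nlinarith
      rw [← add_assoc, psum_succ]
      have h1 := hf (n + d)
      push_cast at h1 ⊢
      have h2 : psum f (n + d) + f (n + d) - psum f n
          = (psum f (n + d) - psum f n) + f (n + d) := by ring
      rw [h2, ← add_assoc (n : ℝ)]
      refine (norm_add_le _ _).trans ?_
      linarith
  have key' : ∀ n m : ℕ, n ≤ m → ‖psum f m - psum f n‖ ≤ 2 * C / (n + 1) := by
    intro n m h
    obtain ⟨d, rfl⟩ := Nat.exists_eq_add_of_le h
    have : 0 ≤ 2 * C / ((n : ℝ) + d + 1) := by positivity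
    linarith [key n d]
  have hlim : Tendsto (fun n : ℕ => 2 * C / ((n : ℝ) + 1)) atTop (𝓝 0) := by
    have := (tendsto_one_div_add_atTop_nhds_zero_nat (𝕜 := ℝ)).const_mul (2 * C)
    simpa [div_eq_mul_inv] using this
  have hcau : CauchySeq (psum f) := by
    refine cauchySeq_of_le_tendsto_0' (fun n : ℕ => 2 * C / ((n : ℝ) + 1)) (fun n m h => ?_) hlim
    rw [dist_comm, dist_eq_norm]
    exact key' n m h
  obtain ⟨L, hL⟩ := cauchySeq_tendsto_of_complete hcau
  refine ⟨L, 2 * C, fun n => ?_⟩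
  rw [norm_sub_rev]
  refine le_of_tendsto (hL.sub_const (psum f n)).norm ?_
  filter_upwards [eventually_ge_atTop n] with m hm using key' n m hm

/-- Write f u = K f + f (u - K); the last term is O(1/n²). Since partial sums of a tame series
converge rapidly, nested series are again tame. -/
lemma mul_rapid {u : ℕ → ℂ} (h : TameSum f L) (hu : RapidTo u K) :
    ∃ L', TameSum (f * u) L' := by
  obtain ⟨C, hC0, hC⟩ := h.exists_norm_le
  obtain ⟨D, hD0, hD⟩ := hu.exists_pos
  obtain ⟨L', hL'⟩ := of_norm_le (f := fun n => f n * (u n - K)) (C := C * D) fun n => by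
    rw [norm_mul, sq, ← div_mul_div_comm]
    exact mul_le_mul (hC n) (hD n) (norm_nonneg _) ((norm_nonneg _).trans (hC n))
  refine ⟨K * L + L', ?_⟩
  have := (h.const_mul K).add hL'
  convert this using 1
  funext n
  simp only [Pi.mul_apply, Pi.add_apply]
  ring

lemma mul_psum_add (h : TameSum f L) (h' : TameSum g K) :
    TameSum (f * psum g + g * psum f + f * g) (L * K) := by
  have := RapidTo.mul h h'
  rwa [show psum f * psum g = psum (f * psum g + g * psum f + f * g) from
    funext fun n => psum_mul_psum f g n] at this

end TameSum

/-! ### Monomials on the integers and their depth one series. -/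

/-- The monomial `X ^ n / n ^ a` on the integers, which vanishes at `n = 0` for `a ≥ 1`. -/
noncomputable def mono (a : ℕ) (X : ℂ) (n : ℤ) : ℂ := X ^ n / (n : ℂ) ^ a

/-- The restriction of a function on the integers to the natural numbers. -/
def pos (F : ℤ → ℂ) (n : ℕ) : ℂ := F n

/-- The restriction of a function on the integers to the negatives of the natural numbers. -/
def neg (F : ℤ → ℂ) (n : ℕ) : ℂ := F (-n)

/-- A positive exponent and a root of unity for which the series of depth one converges. -/
structure Nondeg (a : ℕ) (X : ℂ) : Prop where
  one_le : 1 ≤ a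
  fin : IsOfFinOrder X
  ne : (a, X) ≠ (1, 1)

lemma ne_zero_of_isOfFinOrder {X : ℂ} (h : IsOfFinOrder X) : X ≠ 0 := h.isUnit.ne_zero

lemma norm_of_isOfFinOrder {X : ℂ} (h : IsOfFinOrder X) : ‖X‖ = 1 := by
  exact h.norm_eq_one

lemma Nondeg.ne_zero {a : ℕ} {X : ℂ} (h : Nondeg a X) : X ≠ 0 := ne_zero_of_isOfFinOrder h.fin

lemma isOfFinOrder_inv {X : ℂ} (h : IsOfFinOrder X) : IsOfFinOrder X⁻¹ := by
  obtain ⟨n, hn, h1⟩ := isOfFinOrder_iff_pow_eq_one.1 h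
  exact isOfFinOrder_iff_pow_eq_one.2 ⟨n, hn, by simp [h1]⟩

lemma Nondeg.inv {a : ℕ} {X : ℂ} (h : Nondeg a X) : Nondeg a X⁻¹ :=
  ⟨h.one_le, isOfFinOrder_inv h.fin, fun h' => h.ne (by simpa using h')⟩

lemma Nondeg.mono_exponent {a b : ℕ} {X : ℂ} (h : Nondeg a X) (hab : a ≤ b) : Nondeg b X := by
  refine ⟨h.one_le.trans hab, h.fin, fun h' => ?_⟩
  simp only [Prod.mk.injEq] at h'
  have := h.one_le
  exact h.ne (by simp only [Prod.mk.injEq]; exact ⟨by omega, h'.2⟩)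

lemma Nondeg.of_two_le {a : ℕ} {X : ℂ} (ha : 2 ≤ a) (h : IsOfFinOrder X) : Nondeg a X :=
  ⟨by omega, h, fun h' => by simp only [Prod.mk.injEq] at h'; omega⟩

lemma mono_zero {a : ℕ} (ha : 1 ≤ a) (X : ℂ) : mono a X 0 = 0 := by
  simp [mono, zero_pow (by omega : a ≠ 0)]

lemma mono_neg (a : ℕ) (X : ℂ) (n : ℤ) : mono a X (-n) = (-1) ^ a * mono a X⁻¹ n := by
  have h : ((-1 : ℂ) ^ a)⁻¹ = (-1) ^ a := by rw [← inv_pow]; norm_num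
  simp only [mono, zpow_neg, inv_zpow, Int.cast_neg]
  rw [neg_pow, div_eq_mul_inv, mul_inv, h]
  ring

lemma mono_mul (a b : ℕ) {X Y : ℂ} (n : ℤ) :
    mono a X n * mono b Y n = mono (a + b) (X * Y) n := by
  simp only [mono, mul_zpow, pow_add]
  ring

lemma pos_mono_mul (a b : ℕ) (X Y : ℂ) :
    pos (mono a X) * pos (mono b Y) = pos (mono (a + b) (X * Y)) :=
  funext fun n => mono_mul a b n

lemma neg_mono (a : ℕ) (X : ℂ) : neg (mono a X) = fun n => (-1) ^ a * pos (mono a X⁻¹) n :=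
  funext fun n => mono_neg a X n

/-- For a ≥ 2 the terms are O(1/n²). For a = 1 and X ≠ 1, summation by parts applies. -/
lemma exists_tameSum_mono {a : ℕ} {X : ℂ} (h : Nondeg a X) : ∃ L, TameSum (pos (mono a X)) L := by
  have hX := norm_of_isOfFinOrder h.fin
  by_cases ha : 2 ≤ a
  · refine TameSum.of_norm_le (C := 4) fun n => ?_
    rcases Nat.eq_zero_or_pos n with rfl | hn
    · simp [pos, mono_zero h.one_le]
    · have hn' : (1 : ℝ) ≤ n := by exact_mod_cast hn
      simp only [pos, mono, norm_div, norm_zpow, hX, one_zpow, norm_pow, Int.cast_natCast,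
        Complex.norm_natCast]
      calc 1 / (n : ℝ) ^ a ≤ 1 / (n : ℝ) ^ 2 :=
            one_div_le_one_div_of_le (by positivity) (pow_le_pow_right₀ hn' ha)
        _ ≤ 4 / (n + 1) ^ 2 := by
            rw [div_le_div_iff₀ (by positivity) (by positivity)]
            nlinarith
  · obtain rfl : a = 1 := by have := h.one_le; omega
    have hX1 : X - 1 ≠ 0 := fun h' => h.ne (by rw [sub_eq_zero.1 h'])
    -- A discrete antiderivative of X^n/n up to O(1/n²): the remainder is X^(n+1)/((X-1) n (n+1))
    -- for n ≥ 1. Division by zero gives w 0 = 0.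
    let w : ℕ → ℂ := fun n => X ^ n / ((X - 1) * n)
    let e : ℕ → ℂ := fun n => pos (mono 1 X) n - (w (n + 1) - w n)
    have hw : TameSum (fun n => w (n + 1) - w n) 0 := by
      refine ⟨2 / ‖X - 1‖, fun n => ?_⟩
      have : psum (fun n => w (n + 1) - w n) n = w n - w 0 := by
        rw [psum, Finset.sum_range_sub]
      rw [this]
      have h0 : 0 < ‖X - 1‖ := norm_pos_iff.2 hX1
      rcases Nat.eq_zero_or_pos n with rfl | hn
      · simpa using by positivity
      · have hn' : (1 : ℝ) ≤ n := by exact_mod_cast hn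
        simp only [w, norm_div, norm_mul, norm_pow, hX, Nat.cast_zero, mul_zero, div_zero,
          sub_zero, one_pow, Complex.norm_natCast]
        rw [div_div, div_le_div_iff₀ (by positivity) (by positivity)]
        nlinarith
    obtain ⟨L, hL⟩ := TameSum.of_norm_le (f := e) (C := 4 * (1 + ‖X - 1‖⁻¹)) fun n => by
      have h0 : 0 < ‖X - 1‖ := norm_pos_iff.2 hX1
      rcases Nat.eq_zero_or_pos n with rfl | hn
      · simp only [e, w, pos, mono]
        simp [hX]
        nlinarith [inv_pos.2 h0]
      · have hn' : (1 : ℝ) ≤ n := by exact_mod_cast hn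
        have hn0 : (n : ℂ) ≠ 0 := by exact_mod_cast hn.ne'
        have hn1 : (n : ℂ) + 1 ≠ 0 := by exact_mod_cast n.succ_ne_zero
        have : e n = X ^ (n + 1) / ((X - 1) * (n * (n + 1 : ℕ))) := by
          simp only [e, w, pos, mono, zpow_natCast, Int.cast_natCast, pow_one]
          push_cast
          field_simp
          ring
        rw [this]
        simp only [norm_div, norm_mul, norm_pow, hX, one_pow, Complex.norm_natCast]
        push_cast
        have h3 : 1 / (‖X - 1‖ * ((n : ℝ) * (n + 1))) = ‖X - 1‖⁻¹ * (1 / (n * (n + 1))) := by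
          field_simp
        have h4 : 1 / ((n : ℝ) * (n + 1)) ≤ 4 / (n + 1) ^ 2 := by
          rw [div_le_div_iff₀ (by positivity) (by positivity)]
          nlinarith
        rw [h3, mul_comm (4 : ℝ), mul_div_assoc]
        exact mul_le_mul (by linarith) h4 (by positivity) (by positivity)
    refine ⟨0 + L, ?_⟩
    convert hw.add hL using 1
    funext n
    simp only [e, Pi.add_apply]
    ring

/-! ### Sums over increasing tuples as nested partial sums. -/

lemma sum_increasingTuples_zero (F : (Fin 0 → ℕ) → ℂ) (M : ℕ) :
    ∑ n ∈ increasingTuples 0 M, F n = F ![] := by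
  have : increasingTuples 0 M = {![]} := by
    ext n
    simp only [increasingTuples, Finset.mem_filter, Fintype.mem_piFinset, Finset.mem_singleton,
      Subsingleton.elim n ![], iff_true]
    exact ⟨fun i => i.elim0, fun i => i.elim0⟩
  rw [this, Finset.sum_singleton]

lemma mem_increasingTuples {r M : ℕ} {n : Fin r → ℕ} :
    n ∈ increasingTuples r M ↔ (∀ i, 1 ≤ n i ∧ n i ≤ M) ∧ StrictMono n := by
  simp [increasingTuples]

lemma sum_increasingTuples_succ (r : ℕ) (F : Fin (r + 1) → ℕ → ℂ) (M : ℕ) :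
    ∑ n ∈ increasingTuples (r + 1) M, ∏ i, F i (n i)
      = ∑ c ∈ Finset.Icc 1 M, F (Fin.last r) c *
          ∑ n ∈ increasingTuples r (c - 1), ∏ i, F i.castSucc (n i) := by
  simp_rw [Finset.mul_sum]
  rw [Finset.sum_sigma']
  refine Finset.sum_bij' (fun n _ => (⟨n (Fin.last r), Fin.init n⟩ : (_ : ℕ) × (Fin r → ℕ)))
    (fun s _ => (Fin.snoc s.2 s.1 : Fin (r + 1) → ℕ)) ?_ ?_ ?_ ?_ ?_
  · intro n hn
    rw [mem_increasingTuples] at hn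
    simp only [Finset.mem_sigma, Finset.mem_Icc, mem_increasingTuples]
    refine ⟨hn.1 _, fun i => ⟨(hn.1 _).1, ?_⟩, fun i j hij => hn.2 (by simpa using hij)⟩
    have := hn.2 (Fin.castSucc_lt_last i)
    simp only [Fin.init]
    omega
  · rintro ⟨c, n⟩ h
    simp only [Finset.mem_sigma, Finset.mem_Icc, mem_increasingTuples] at h ⊢
    refine ⟨fun i => ?_, fun i j hij => ?_⟩
    · refine Fin.lastCases ?_ (fun i => ?_) i
      · simpa using h.1
      · have := h.2.1 i
        simp only [Fin.snoc_castSucc]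
        omega
    · induction j using Fin.lastCases with
      | last =>
        induction i using Fin.lastCases with
        | last => exact absurd hij (lt_irrefl _)
        | cast i =>
          have := h.2.1 i
          simp only [Fin.snoc_castSucc, Fin.snoc_last]
          omega
      | cast j =>
        induction i using Fin.lastCases with
        | last => exact absurd (hij.trans (Fin.castSucc_lt_last j)) (lt_irrefl _)
        | cast i =>
          simp only [Fin.snoc_castSucc]
          exact h.2.2 (by simpa using hij)
  · intro n _
    exact Fin.snoc_init_self n
  · rintro ⟨c, n⟩ _
    simp
  · intro n _
    rw [Fin.prod_univ_castSucc, mul_comm]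
    rfl

/-- `psum` starts at 0 and excludes its upper bound, hence the vanishing condition and the shift by
one. -/
lemma sum_Icc_eq_psum {f : ℕ → ℂ} (h : f 0 = 0) (M : ℕ) :
    ∑ c ∈ Finset.Icc 1 M, f c = psum f (M + 1) := by
  induction M with
  | zero => simp [psum, h]
  | succ M ih => rw [Finset.sum_Icc_succ_top (by omega), ih, psum_succ _ (M + 1)]

lemma sum_increasingTuples_one (F : Fin 1 → ℕ → ℂ) (h : F 0 0 = 0) (M : ℕ) :
    ∑ n ∈ increasingTuples 1 M, ∏ i, F i (n i) = psum (F 0) (M + 1) := by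
  rw [sum_increasingTuples_succ]
  simp only [sum_increasingTuples_zero, Finset.univ_eq_empty, Finset.prod_empty, mul_one]
  exact sum_Icc_eq_psum h M

lemma sum_increasingTuples_two (F : Fin 2 → ℕ → ℂ) (h : F 0 0 = 0) (M : ℕ) :
    ∑ n ∈ increasingTuples 2 M, ∏ i, F i (n i) = psum (F 1 * psum (F 0)) (M + 1) := by
  rw [sum_increasingTuples_succ, ← sum_Icc_eq_psum (by simp [psum_zero])]
  refine Finset.sum_congr rfl fun c hc => ?_
  obtain ⟨hc, -⟩ := Finset.mem_Icc.1 hc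
  rw [sum_increasingTuples_one (fun i => F i.castSucc) h, Nat.sub_add_cancel hc]
  rfl

lemma sum_increasingTuples_three (F : Fin 3 → ℕ → ℂ) (h : F 0 0 = 0) (M : ℕ) :
    ∑ n ∈ increasingTuples 3 M, ∏ i, F i (n i)
      = psum (F 2 * psum (F 1 * psum (F 0))) (M + 1) := by
  rw [sum_increasingTuples_succ, ← sum_Icc_eq_psum (by simp [psum_zero])]
  refine Finset.sum_congr rfl fun c hc => ?_
  obtain ⟨hc, -⟩ := Finset.mem_Icc.1 hc
  rw [sum_increasingTuples_two (fun i => F i.castSucc) h, Nat.sub_add_cancel hc]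
  rfl

/-! ### The space of values of depth at most two. -/

lemma mul_mem_rationalCombinationsOfProducts {d : ℕ} {u v : ℂ}
    (hu : u ∈ rationalCombinationsOfProducts d) (hv : v ∈ rationalCombinationsOfProducts d) :
    u * v ∈ rationalCombinationsOfProducts d := by
  unfold rationalCombinationsOfProducts at *
  induction hu, hv using Submodule.span_induction₂ with
  | mem_mem x y hx hy => exact Submodule.subset_span (mul_mem hx hy)
  | zero_left y hy => simp
  | zero_right x hx => simp
  | add_left x y z _ _ _ h1 h2 => rw [add_mul]; exact add_mem h1 h2
  | add_right x y z _ _ _ h1 h2 => rw [mul_add]; exact add_mem h1 h2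
  | smul_left c x y _ _ h => rw [smul_mul_assoc]; exact Submodule.smul_mem _ _ h
  | smul_right c x y _ _ h => rw [mul_smul_comm]; exact Submodule.smul_mem _ _ h

/-- The space of values in the theorem. -/
noncomputable abbrev depthTwo : Submodule ℚ ℂ := rationalCombinationsOfProducts 2

/-- The sequences whose series converges, with tails `O(1 / n)`, to an element of `depthTwo`. -/
noncomputable def depthTwoSeries : Submodule ℚ (ℕ → ℂ) where
  carrier := {f | ∃ v ∈ depthTwo, TameSum f v}
  zero_mem' := ⟨0, zero_mem _, 0, fun n => by simp [psum]⟩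
  add_mem' := by
    rintro f g ⟨v, hv, hf⟩ ⟨w, hw, hg⟩
    exact ⟨v + w, add_mem hv hw, hf.add hg⟩
  smul_mem' := by
    rintro c f ⟨v, hv, hf⟩
    refine ⟨c • v, Submodule.smul_mem _ _ hv, ?_⟩
    convert hf.const_mul (c : ℂ) using 1
    · funext n; simp [Rat.smul_def]
    · simp [Rat.smul_def]

lemma const_mul_mem_depthTwoSeries {f : ℕ → ℂ} (hf : f ∈ depthTwoSeries) {c : ℂ}
    (hc : c ∈ depthTwo) : (fun n => c * f n) ∈ depthTwoSeries := by
  obtain ⟨v, hv, hf⟩ := hf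
  exact ⟨c * v, mul_mem_rationalCombinationsOfProducts hc hv, hf.const_mul c⟩

lemma sign_mul_mem_depthTwoSeries {f : ℕ → ℂ} (hf : f ∈ depthTwoSeries) (a : ℕ) :
    (fun n => (-1) ^ a * f n) ∈ depthTwoSeries := by
  convert Submodule.smul_mem _ ((-1 : ℚ) ^ a) hf using 1
  funext n
  simp [Rat.smul_def]

lemma mul_psum_add_mem_depthTwoSeries {f g : ℕ → ℂ} (hf : f ∈ depthTwoSeries)
    (hg : g ∈ depthTwoSeries) : f * psum g + g * psum f + f * g ∈ depthTwoSeries := by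
  obtain ⟨v, hv, hf⟩ := hf
  obtain ⟨w, hw, hg⟩ := hg
  exact ⟨v * w, mul_mem_rationalCombinationsOfProducts hv hw, hf.mul_psum_add hg⟩

/-- Separates the rate of convergence from the value: the latter may come from a limit with no rate.
-/
lemma mem_depthTwoSeries_of_tendsto {f : ℕ → ℂ} {L v : ℂ} (hf : TameSum f L)
    (hv : v ∈ depthTwo) (h : Tendsto (psum f) atTop (𝓝 v)) : f ∈ depthTwoSeries := by
  obtain rfl := tendsto_nhds_unique hf.tendsto h
  exact ⟨_, hv, hf⟩

lemma multipleZeta_mem_depthTwo {r : ℕ} {k : Fin (r + 1) → ℕ} {x : Fin (r + 1) → ℂ}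
    (hr : r + 1 ≤ 2) (h : IsAdmissible k x) : multipleZeta k x ∈ depthTwo :=
  Submodule.subset_span (Subsemigroup.subset_closure (Or.inr ⟨r, k, x, hr, h, rfl⟩))

lemma pos_mono (a : ℕ) (X : ℂ) (n : ℕ) : pos (mono a X) n = X ^ n / (n : ℂ) ^ a := by
  simp [pos, mono]

lemma pos_mono_mem {a : ℕ} {X : ℂ} (h : Nondeg a X) : pos (mono a X) ∈ depthTwoSeries := by
  obtain ⟨L, hL⟩ := exists_tameSum_mono h
  have hv : multipleZeta ![a] ![X] = L := by
    refine Tendsto.limUnder_eq ?_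
    have := hL.tendsto.comp (tendsto_add_atTop_nat 1)
    convert this using 1
    funext M
    simp only [multipleZetaPartial, Function.comp]
    rw [sum_increasingTuples_one (fun i n => ![X] i ^ n / (n : ℂ) ^ (![a] i))]
    · congr 1
    · simpa [pos, mono] using mono_zero h.one_le X
  refine ⟨L, hv ▸ multipleZeta_mem_depthTwo (by norm_num) ⟨?_, ?_, ?_⟩, hL⟩
  · simpa using h.one_le
  · simpa using h.fin
  · simpa using h.ne

lemma neg_mono_mem {a : ℕ} {X : ℂ} (h : Nondeg a X) : neg (mono a X) ∈ depthTwoSeries := by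
  rw [neg_mono]
  exact sign_mul_mem_depthTwoSeries (pos_mono_mem h.inv) a

lemma exists_tameSum_mul_psum {f g : ℕ → ℂ} (hf : ∃ L, TameSum f L) (hg : ∃ L, TameSum g L) :
    ∃ L, TameSum (f * psum g) L := by
  obtain ⟨L, hf⟩ := hf
  obtain ⟨K, hg⟩ := hg
  exact hf.mul_rapid hg

lemma exists_tameSum_of_mem {f : ℕ → ℂ} (hf : f ∈ depthTwoSeries) : ∃ L, TameSum f L := by
  obtain ⟨v, -, h⟩ := hf
  exact ⟨v, h⟩

lemma pos_mono_mul_psum_mem {a b : ℕ} {X Y : ℂ} (ha : Nondeg a X) (hb : Nondeg b Y) :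
    pos (mono b Y) * psum (pos (mono a X)) ∈ depthTwoSeries := by
  obtain ⟨L, hL⟩ := exists_tameSum_mul_psum (exists_tameSum_mono hb) (exists_tameSum_mono ha)
  have hv : multipleZeta ![a, b] ![X, Y] = L := by
    refine Tendsto.limUnder_eq ?_
    have := hL.tendsto.comp (tendsto_add_atTop_nat 1)
    convert this using 1
    funext M
    simp only [multipleZetaPartial, Function.comp]
    rw [sum_increasingTuples_two (fun i n => ![X, Y] i ^ n / (n : ℂ) ^ (![a, b] i))]
    · congr 1
    · simpa [pos, mono] using mono_zero ha.one_le X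
  refine ⟨L, hv ▸ multipleZeta_mem_depthTwo (by norm_num) ⟨?_, ?_, ?_⟩, hL⟩
  · simpa [Fin.forall_fin_two] using ⟨ha.one_le, hb.one_le⟩
  · simpa [Fin.forall_fin_two] using ⟨ha.fin, hb.fin⟩
  · simpa [Fin.last] using hb.ne

lemma psum_sign_mul (a : ℕ) (f : ℕ → ℂ) :
    psum (fun n => (-1) ^ a * f n) = fun n => (-1) ^ a * psum f n :=
  funext fun n => psum_mul_left _ _ n

lemma neg_mono_mul_psum_mem {a b : ℕ} {X Y : ℂ} (ha : Nondeg a X) (hb : Nondeg b Y) :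
    neg (mono b Y) * psum (neg (mono a X)) ∈ depthTwoSeries := by
  convert sign_mul_mem_depthTwoSeries (pos_mono_mul_psum_mem ha.inv hb.inv) (a + b) using 1
  rw [neg_mono, neg_mono, psum_sign_mul]
  funext n
  simp only [Pi.mul_apply, pow_add]
  ring

lemma pos_mono_mul_psum_neg_mem {a b : ℕ} {X Y : ℂ} (ha : Nondeg a X) (hb : Nondeg b Y) :
    pos (mono b Y) * psum (neg (mono a X)) ∈ depthTwoSeries := by
  convert sign_mul_mem_depthTwoSeries (pos_mono_mul_psum_mem ha.inv hb) a using 1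
  rw [neg_mono, psum_sign_mul]
  funext n
  simp only [Pi.mul_apply]
  ring

lemma neg_mono_mul_psum_pos_mem {a b : ℕ} {X Y : ℂ} (ha : Nondeg a X) (hb : Nondeg b Y) :
    neg (mono b Y) * psum (pos (mono a X)) ∈ depthTwoSeries := by
  convert sign_mul_mem_depthTwoSeries (pos_mono_mul_psum_mem ha hb.inv) b using 1
  rw [neg_mono]
  funext n
  simp only [Pi.mul_apply]
  ring

/-! ### Partial fractions with three poles. -/

/-- The terms of the partial fraction decomposition of
`1 / ((s - α) ^ r (s - β) ^ p (s - γ) ^ q)` in the variable `s`. -/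
def partialFractionTerms (r p q : ℕ) : Set (ℂ → ℂ → ℂ → ℂ → ℂ) :=
  {t | ∃ a b j, p ≤ a ∧ q ≤ b ∧ 1 ≤ j ∧
      t = fun α β γ s => ((β - α) ^ a * (γ - α) ^ b * (s - α) ^ j)⁻¹} ∪
  {t | ∃ a b j, r ≤ a ∧ q ≤ b ∧ 1 ≤ j ∧
      t = fun α β γ s => ((α - β) ^ a * (γ - β) ^ b * (s - β) ^ j)⁻¹} ∪
  {t | ∃ a b j, r ≤ a ∧ p ≤ b ∧ 1 ≤ j ∧
      t = fun α β γ s => ((α - γ) ^ a * (β - γ) ^ b * (s - γ) ^ j)⁻¹}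

/-- The four complex numbers are distinct. -/
def Distinct (α β γ s : ℂ) : Prop :=
  α ≠ β ∧ α ≠ γ ∧ α ≠ s ∧ β ≠ γ ∧ β ≠ s ∧ γ ≠ s

/-- The function `1 / ((s - α) ^ r (s - β) ^ p (s - γ) ^ q)` is a rational linear combination of
the partial fraction terms. -/
def HasPartialFractions (r p q : ℕ) : Prop :=
  ∃ t ∈ Submodule.span ℚ (partialFractionTerms r p q), ∀ α β γ s, Distinct α β γ s →
    t α β γ s = ((s - α) ^ r * (s - β) ^ p * (s - γ) ^ q)⁻¹

lemma hasPartialFractions_one : HasPartialFractions 1 1 1 := by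
  refine ⟨(fun α β γ s => ((β - α) ^ 1 * (γ - α) ^ 1 * (s - α) ^ 1)⁻¹) +
    (fun α β γ s => ((α - β) ^ 1 * (γ - β) ^ 1 * (s - β) ^ 1)⁻¹) +
    (fun α β γ s => ((α - γ) ^ 1 * (β - γ) ^ 1 * (s - γ) ^ 1)⁻¹), ?_, ?_⟩
  · refine add_mem (add_mem ?_ ?_) ?_ <;> refine Submodule.subset_span ?_
    · exact Or.inl (Or.inl ⟨1, 1, 1, le_rfl, le_rfl, le_rfl, rfl⟩)
    · exact Or.inl (Or.inr ⟨1, 1, 1, le_rfl, le_rfl, le_rfl, rfl⟩)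
    · exact Or.inr ⟨1, 1, 1, le_rfl, le_rfl, le_rfl, rfl⟩
  · rintro α β γ s ⟨h1, h2, h3, h4, h5, h6⟩
    have e1 := sub_ne_zero.2 h1
    have e2 := sub_ne_zero.2 h2
    have e3 := sub_ne_zero.2 h3.symm
    have e4 := sub_ne_zero.2 h4
    have e5 := sub_ne_zero.2 h5.symm
    have e6 := sub_ne_zero.2 h6.symm
    simp only [Pi.add_apply, pow_one]
    rw [← neg_sub α β, ← neg_sub α γ, ← neg_sub β γ]
    field_simp
    ring

lemma HasPartialFractions.swap {r p q : ℕ} (h : HasPartialFractions r p q) :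
    HasPartialFractions p r q := by
  obtain ⟨t, ht, h⟩ := h
  let φ : (ℂ → ℂ → ℂ → ℂ → ℂ) →ₗ[ℚ] (ℂ → ℂ → ℂ → ℂ → ℂ) :=
    { toFun := fun t α β γ s => t β α γ s
      map_add' := fun _ _ => rfl
      map_smul' := fun _ _ => rfl }
  refine ⟨φ t, ?_, ?_⟩
  · refine Submodule.span_induction (p := fun t _ => φ t ∈ _) ?_ (by simp)
      (fun x y _ _ hx hy => by rw [map_add]; exact add_mem hx hy)
      (fun c x _ hx => by rw [map_smul]; exact Submodule.smul_mem _ _ hx) ht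
    rintro t ((⟨a, b, j, ha, hb, hj, rfl⟩ | ⟨a, b, j, ha, hb, hj, rfl⟩) |
      ⟨a, b, j, ha, hb, hj, rfl⟩)
    · exact Submodule.subset_span (Or.inl (Or.inr ⟨a, b, j, ha, hb, hj, rfl⟩))
    · exact Submodule.subset_span (Or.inl (Or.inl ⟨a, b, j, ha, hb, hj, rfl⟩))
    · refine Submodule.subset_span (Or.inr ⟨b, a, j, hb, ha, hj, ?_⟩)
      funext α β γ s
      simp only [φ, LinearMap.coe_mk, AddHom.coe_mk]
      ring
  · rintro α β γ s ⟨h1, h2, h3, h4, h5, h6⟩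
    simp only [φ, LinearMap.coe_mk, AddHom.coe_mk]
    rw [h β α γ s ⟨h1.symm, h4, h5, h2, h3, h6⟩]
    ring

lemma HasPartialFractions.swap' {r p q : ℕ} (h : HasPartialFractions r p q) :
    HasPartialFractions q p r := by
  obtain ⟨t, ht, h⟩ := h
  let φ : (ℂ → ℂ → ℂ → ℂ → ℂ) →ₗ[ℚ] (ℂ → ℂ → ℂ → ℂ → ℂ) :=
    { toFun := fun t α β γ s => t γ β α s
      map_add' := fun _ _ => rfl
      map_smul' := fun _ _ => rfl }
  refine ⟨φ t, ?_, ?_⟩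
  · refine Submodule.span_induction (p := fun t _ => φ t ∈ _) ?_ (by simp)
      (fun x y _ _ hx hy => by rw [map_add]; exact add_mem hx hy)
      (fun c x _ hx => by rw [map_smul]; exact Submodule.smul_mem _ _ hx) ht
    rintro t ((⟨a, b, j, ha, hb, hj, rfl⟩ | ⟨a, b, j, ha, hb, hj, rfl⟩) |
      ⟨a, b, j, ha, hb, hj, rfl⟩)
    · refine Submodule.subset_span (Or.inr ⟨b, a, j, hb, ha, hj, ?_⟩)
      funext α β γ s
      simp only [φ, LinearMap.coe_mk, AddHom.coe_mk]
      ring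
    · refine Submodule.subset_span (Or.inl (Or.inr ⟨b, a, j, hb, ha, hj, ?_⟩))
      funext α β γ s
      simp only [φ, LinearMap.coe_mk, AddHom.coe_mk]
      ring
    · refine Submodule.subset_span (Or.inl (Or.inl ⟨b, a, j, hb, ha, hj, ?_⟩))
      funext α β γ s
      simp only [φ, LinearMap.coe_mk, AddHom.coe_mk]
      ring
  · rintro α β γ s ⟨h1, h2, h3, h4, h5, h6⟩
    simp only [φ, LinearMap.coe_mk, AddHom.coe_mk]
    rw [h γ β α s ⟨h4.symm, h2.symm, h6, h1.symm, h5, h3⟩]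
    ring

lemma HasDerivAt.congr_both {f g : ℂ → ℂ} {f' g' a : ℂ} (h : HasDerivAt f f' a)
    (hf : ∀ x, g x = f x) (he : f' = g') : HasDerivAt g g' a := by
  rwa [funext hf, ← he]

lemma hasDerivAt_inv_pow_sub (c α : ℂ) (h : c - α ≠ 0) (n : ℕ) :
    HasDerivAt (fun α => ((c - α) ^ n)⁻¹) (n * ((c - α) ^ (n + 1))⁻¹) α := by
  have h1 : HasDerivAt (fun α => (c - α) ^ n) (n * (c - α) ^ (n - 1) * (-1)) α :=
    ((hasDerivAt_id α).const_sub c).pow n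
  refine (h1.inv (pow_ne_zero n h)).congr_both (fun _ => rfl) ?_
  rcases n with _ | n
  · simp
  · simp only [Nat.add_sub_cancel]
    field_simp
    ring

lemma hasDerivAt_inv_pow_sub' (c α : ℂ) (h : α - c ≠ 0) (n : ℕ) :
    HasDerivAt (fun α => ((α - c) ^ n)⁻¹) (-(n * ((α - c) ^ (n + 1))⁻¹)) α := by
  have h1 : HasDerivAt (fun α => (α - c) ^ n) (n * (α - c) ^ (n - 1) * 1) α :=
    ((hasDerivAt_id α).sub_const c).pow n
  refine (h1.inv (pow_ne_zero n h)).congr_both (fun _ => rfl) ?_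
  rcases n with _ | n
  · simp
  · simp only [Nat.add_sub_cancel]
    field_simp
    ring

/-- Differentiating in α raises exponents by one. In the terms with pole at β or γ it hits only the
factor whose exponent is at least r, so the bound improves to r + 1. These lower bounds matter
later: they keep every pair (exponent, argument) different from (1, 1). -/
lemma exists_deriv_mem_span {r p q : ℕ} {t : ℂ → ℂ → ℂ → ℂ → ℂ}
    (ht : t ∈ Submodule.span ℚ (partialFractionTerms r p q)) :
    ∃ t' ∈ Submodule.span ℚ (partialFractionTerms (r + 1) p q), ∀ α β γ s, Distinct α β γ s →
      HasDerivAt (fun α => t α β γ s) (t' α β γ s) α := by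
  induction ht using Submodule.span_induction with
  | mem t ht =>
    rcases ht with (⟨a, b, j, ha, hb, hj, rfl⟩ | ⟨a, b, j, ha, hb, hj, rfl⟩) |
      ⟨a, b, j, ha, hb, hj, rfl⟩
    · refine ⟨(a : ℚ) • (fun α β γ s => ((β - α) ^ (a + 1) * (γ - α) ^ b * (s - α) ^ j)⁻¹) +
        (b : ℚ) • (fun α β γ s => ((β - α) ^ a * (γ - α) ^ (b + 1) * (s - α) ^ j)⁻¹) +
        (j : ℚ) • (fun α β γ s => ((β - α) ^ a * (γ - α) ^ b * (s - α) ^ (j + 1))⁻¹), ?_, ?_⟩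
      · refine add_mem (add_mem ?_ ?_) ?_ <;>
          refine Submodule.smul_mem _ _ (Submodule.subset_span (Or.inl (Or.inl
            ⟨_, _, _, ?_, ?_, ?_, rfl⟩))) <;> omega
      · rintro α β γ s ⟨h1, h2, h3, -⟩
        have := ((hasDerivAt_inv_pow_sub β α (sub_ne_zero.2 h1.symm) a).mul
          (hasDerivAt_inv_pow_sub γ α (sub_ne_zero.2 h2.symm) b)).mul
          (hasDerivAt_inv_pow_sub s α (sub_ne_zero.2 h3.symm) j)
        refine this.congr_both (fun α => ?_) ?_
        · simp only [mul_inv, Pi.mul_apply]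
        · simp [Rat.smul_def]
          ring
    · refine ⟨-(a : ℚ) • (fun α β γ s => ((α - β) ^ (a + 1) * (γ - β) ^ b * (s - β) ^ j)⁻¹),
        ?_, ?_⟩
      · refine Submodule.smul_mem _ _ (Submodule.subset_span (Or.inl (Or.inr
            ⟨_, _, _, ?_, ?_, ?_, rfl⟩))) <;> omega
      · rintro α β γ s ⟨h1, -⟩
        have := (hasDerivAt_inv_pow_sub' β α (sub_ne_zero.2 h1) a).mul_const
          (((γ - β) ^ b * (s - β) ^ j)⁻¹)
        refine this.congr_both (fun α => ?_) ?_
        · simp only [mul_assoc, mul_inv]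
        · simp [Rat.smul_def]
          ring
    · refine ⟨-(a : ℚ) • (fun α β γ s => ((α - γ) ^ (a + 1) * (β - γ) ^ b * (s - γ) ^ j)⁻¹),
        ?_, ?_⟩
      · refine Submodule.smul_mem _ _ (Submodule.subset_span (Or.inr
            ⟨_, _, _, ?_, ?_, ?_, rfl⟩)) <;> omega
      · rintro α β γ s ⟨-, h2, -⟩
        have := (hasDerivAt_inv_pow_sub' γ α (sub_ne_zero.2 h2) a).mul_const
          (((β - γ) ^ b * (s - γ) ^ j)⁻¹)
        refine this.congr_both (fun α => ?_) ?_
        · simp only [mul_assoc, mul_inv]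
        · simp [Rat.smul_def]
          ring
  | zero => exact ⟨0, zero_mem _, fun α β γ s _ => hasDerivAt_const α _⟩
  | add t u _ _ h1 h2 =>
    obtain ⟨t', ht', h1⟩ := h1
    obtain ⟨u', hu', h2⟩ := h2
    exact ⟨t' + u', add_mem ht' hu', fun α β γ s h => (h1 α β γ s h).add (h2 α β γ s h)⟩
  | smul c t _ h1 =>
    obtain ⟨t', ht', h1⟩ := h1
    refine ⟨c • t', Submodule.smul_mem _ _ ht', fun α β γ s h => ?_⟩
    simpa [Rat.smul_def] using (h1 α β γ s h).const_mul (c : ℂ)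

/-- Differentiate the decomposition in α and divide by r. Distinctness is an open condition on α, so
the two sides agree near α and have equal derivatives there. -/
lemma HasPartialFractions.succ {r p q : ℕ} (hr : 1 ≤ r) (h : HasPartialFractions r p q) :
    HasPartialFractions (r + 1) p q := by
  obtain ⟨t, ht, h⟩ := h
  obtain ⟨t', ht', hd⟩ := exists_deriv_mem_span ht
  refine ⟨(r : ℚ)⁻¹ • t', Submodule.smul_mem _ _ ht', fun α β γ s hD => ?_⟩
  have hd1 := hd α β γ s hD
  have hr' : (r : ℂ) ≠ 0 := by exact_mod_cast (by omega : r ≠ 0)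
  obtain ⟨h1, h2, h3, h4, h5, h6⟩ := hD
  have hd2 := (hasDerivAt_inv_pow_sub s α (sub_ne_zero.2 h3.symm) r).mul_const
    (((s - β) ^ p * (s - γ) ^ q)⁻¹)
  have heq : (fun α => t α β γ s) =ᶠ[𝓝 α]
      fun α => ((s - α) ^ r)⁻¹ * ((s - β) ^ p * (s - γ) ^ q)⁻¹ := by
    filter_upwards [isOpen_ne.mem_nhds h1, isOpen_ne.mem_nhds h2, isOpen_ne.mem_nhds h3]
      with α' h1' h2' h3'
    rw [h α' β γ s ⟨h1', h2', h3', h4, h5, h6⟩, mul_assoc, mul_inv]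
  have := hd1.unique (hd2.congr_of_eventuallyEq heq)
  simp only [Pi.smul_apply, this, Rat.smul_def, Rat.cast_inv, Rat.cast_natCast, mul_inv]
  field_simp

/-- Each exponent is raised in turn after a symmetry has moved it to the first place. -/
lemma hasPartialFractions {r p q : ℕ} (hr : 1 ≤ r) (hp : 1 ≤ p) (hq : 1 ≤ q) :
    HasPartialFractions r p q := by
  have h1 : HasPartialFractions r 1 1 := by
    induction r, hr using Nat.le_induction with
    | base => exact hasPartialFractions_one
    | succ r hr ih => exact ih.succ hr
  have h2 : HasPartialFractions p r 1 := by
    induction p, hp using Nat.le_induction with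
    | base => exact h1.swap
    | succ p hp ih => exact ih.succ hp
  have h3 : HasPartialFractions q p r := by
    induction q, hq using Nat.le_induction with
    | base => exact h2.swap.swap'
    | succ q hq ih => exact ih.succ hq
  exact h3.swap'

/-! ### Symmetric sums over the integers. -/

/-- The symmetric partial sum over `-M ≤ m ≤ M`. -/
noncomputable def bsum (F : ℤ → ℂ) (M : ℕ) : ℂ := ∑ m ∈ Finset.Icc (-(M : ℤ)) M, F m

/-- The symmetric partial sums of `F` over the integers converge to `c`. -/
def BiTo (F : ℤ → ℂ) (c : ℂ) : Prop := Tendsto (bsum F) atTop (𝓝 c)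

lemma bsum_zero (F : ℤ → ℂ) : bsum F 0 = F 0 := by simp [bsum]

lemma bsum_succ (F : ℤ → ℂ) (M : ℕ) :
    bsum F (M + 1) = bsum F M + F (M + 1) + F (-(M + 1)) := by
  have : Finset.Icc (-((M + 1 : ℕ) : ℤ)) (M + 1 : ℕ)
      = insert ((M : ℤ) + 1) (insert (-((M : ℤ) + 1)) (Finset.Icc (-(M : ℤ)) M)) := by
    ext m
    simp only [Finset.mem_Icc, Finset.mem_insert]
    push_cast
    omega
  rw [bsum, this, Finset.sum_insert, Finset.sum_insert, bsum]
  · ring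
  · simp only [Finset.mem_Icc]; omega
  · simp only [Finset.mem_insert, Finset.mem_Icc]; omega

lemma bsum_eq_psum (F : ℤ → ℂ) (M : ℕ) :
    bsum F M = psum (pos F) (M + 1) + psum (neg F) (M + 1) - F 0 := by
  induction M with
  | zero => simp [bsum_zero, psum, pos, neg]
  | succ M ih =>
    rw [bsum_succ, ih, psum_succ _ (M + 1), psum_succ _ (M + 1)]
    simp only [pos, neg]
    push_cast
    ring

lemma bsum_comp_sub_one (F : ℤ → ℂ) (M : ℕ) :
    bsum (fun m => F (m - 1)) M = bsum F M - F M + F (-(M + 1)) := by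
  induction M with
  | zero => simp [bsum_zero]
  | succ M ih =>
    rw [bsum_succ, bsum_succ, ih]
    push_cast
    rw [show -((M : ℤ) + 1) - 1 = -(M + 1 + 1) by ring, add_sub_cancel_right]
    ring

lemma BiTo.const_mul {F : ℤ → ℂ} {c : ℂ} (h : BiTo F c) (a : ℂ) :
    BiTo (fun m => a * F m) (a * c) := by
  have := Tendsto.const_mul a h
  exact this.congr fun M => by simp only [bsum, Finset.mul_sum]

lemma BiTo.add {F G : ℤ → ℂ} {c d : ℂ} (h : BiTo F c) (h' : BiTo G d) :
    BiTo (fun m => F m + G m) (c + d) := by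
  have := Tendsto.add h h'
  exact this.congr fun M => by simp only [bsum, Finset.sum_add_distrib]

lemma BiTo.sum {ι : Type*} {s : Finset ι} {F : ι → ℤ → ℂ} {c : ι → ℂ}
    (h : ∀ i ∈ s, BiTo (F i) (c i)) : BiTo (fun m => ∑ i ∈ s, F i m) (∑ i ∈ s, c i) := by
  have := tendsto_finsetSum s h
  refine this.congr fun M => ?_
  simp only [bsum]
  rw [Finset.sum_comm]

/-- A unit shift of a symmetric sum changes only two boundary terms, and both tend to 0. -/
lemma BiTo.shift {F : ℤ → ℂ} {c : ℂ} (h : BiTo F c) (h0 : Tendsto F cofinite (𝓝 0)) (k : ℕ) :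
    BiTo (fun m => F (m - k)) c := by
  induction k with
  | zero => simpa using h
  | succ k ih =>
    have hG : Tendsto (fun m => F (m - k)) cofinite (𝓝 0) :=
      h0.comp (sub_left_injective.tendsto_cofinite)
    have h1 : Tendsto (fun M : ℕ => F ((M : ℤ) - k)) atTop (𝓝 0) := by
      rw [← Nat.cofinite_eq_atTop]
      exact hG.comp (Nat.cast_injective (R := ℤ)).tendsto_cofinite
    have h2 : Tendsto (fun M : ℕ => F (-((M : ℤ) + 1) - k)) atTop (𝓝 0) := by
      rw [← Nat.cofinite_eq_atTop]
      refine hG.comp (g := fun m => F (m - k)) (f := fun M : ℕ => -((M : ℤ) + 1)) ?_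
      refine Function.Injective.tendsto_cofinite fun a b hab => ?_
      simpa using hab
    have h3 := (Tendsto.sub ih h1).add h2
    rw [sub_zero, add_zero] at h3
    refine h3.congr fun M => ?_
    rw [← bsum_comp_sub_one (fun m => F (m - k)) M]
    congr 1
    funext m
    congr 1
    push_cast
    ring

lemma BiTo.exclude {F : ℤ → ℂ} {c : ℂ} (h : BiTo F c) (a : ℤ) :
    BiTo (fun m => if m = a then 0 else F m) (c - F a) := by
  have := Tendsto.sub_const h (F a)
  refine this.congr' ?_
  filter_upwards [eventually_ge_atTop a.natAbs] with M hM
  have hmem : a ∈ Finset.Icc (-(M : ℤ)) M := by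
    rw [Finset.mem_Icc]; omega
  rw [bsum, bsum, ← Finset.add_sum_erase _ _ hmem, ← Finset.add_sum_erase _ (fun m => ite _ _ _) hmem,
    if_pos rfl, zero_add, add_sub_cancel_left]
  exact Finset.sum_congr rfl fun m hm => by rw [if_neg (Finset.ne_of_mem_erase hm)]

lemma tendsto_mono_cofinite {j : ℕ} {ζ : ℂ} (hj : 1 ≤ j) (hζ : IsOfFinOrder ζ) :
    Tendsto (mono j ζ) cofinite (𝓝 0) := by
  rw [tendsto_zero_iff_norm_tendsto_zero]
  have h1 : Tendsto (fun n : ℤ => ‖(n : ℝ)‖⁻¹) cofinite (𝓝 0) :=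
    tendsto_inv_atTop_zero.comp (tendsto_norm_cocompact_atTop.comp Int.tendsto_coe_cofinite)
  refine squeeze_zero (fun _ => norm_nonneg _) (fun n => ?_) h1
  rcases eq_or_ne n 0 with rfl | hn
  · simp [mono_zero hj]
  · have hn' : (1 : ℝ) ≤ ‖(n : ℝ)‖ := by
      rw [Real.norm_eq_abs, ← Int.cast_abs]
      exact_mod_cast Int.one_le_abs hn
    rw [mono, norm_div, norm_zpow, norm_of_isOfFinOrder hζ, one_zpow, norm_pow, one_div,
      Complex.norm_intCast, ← Real.norm_eq_abs]
    exact inv_anti₀ (by linarith) (le_self_pow₀ hn' (by omega))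

lemma exists_biTo_mono {j : ℕ} {ζ : ℂ} (hj : 1 ≤ j) (hζ : IsOfFinOrder ζ) :
    ∃ c ∈ depthTwo, BiTo (mono j ζ) c := by
  -- For ζ = j = 1 neither half converges, but 1/n is odd and the symmetric sums vanish. This
  -- degenerate pair can arise, since ζ is a quotient of the given arguments.
  by_cases h : (j, ζ) = (1, 1)
  · obtain ⟨rfl, rfl⟩ := Prod.mk.inj h
    refine ⟨0, zero_mem _, ?_⟩
    have : bsum (mono 1 1) = fun _ => 0 := by
      funext M
      induction M with
      | zero => simp [bsum_zero, mono_zero]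
      | succ M ih => rw [bsum_succ, ih, mono_neg]; simp
    rw [BiTo, this]
    exact tendsto_const_nhds
  · have hn : Nondeg j ζ := ⟨hj, hζ, h⟩
    obtain ⟨v, hv, h1⟩ := pos_mono_mem hn
    obtain ⟨w, hw, h2⟩ := neg_mono_mem hn
    refine ⟨v + w, add_mem hv hw, ?_⟩
    have := (h1.tendsto.comp (tendsto_add_atTop_nat 1)).add
      (h2.tendsto.comp (tendsto_add_atTop_nat 1))
    refine this.congr fun M => ?_
    rw [bsum_eq_psum, mono_zero hj, sub_zero]
    rfl

/-! ### Double series off the diagonal. -/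

/-- The double series of `D k l` over positive `k ≠ l`, summed over squares, converges to an
element of `depthTwo`. -/
def PairSeries (D : ℕ → ℕ → ℂ) : Prop :=
  ∃ v ∈ depthTwo, Tendsto (fun N : ℕ => ∑ k ∈ Finset.Icc 1 N, ∑ l ∈ Finset.Icc 1 N,
    if k = l then 0 else D k l) atTop (𝓝 v)

namespace PairSeries

variable {D E : ℕ → ℕ → ℂ}

lemma add (h : PairSeries D) (h' : PairSeries E) : PairSeries fun k l => D k l + E k l := by
  obtain ⟨v, hv, h⟩ := h
  obtain ⟨w, hw, h'⟩ := h'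
  refine ⟨v + w, add_mem hv hw, (h.add h').congr fun N => ?_⟩
  simp only [← Finset.sum_add_distrib]
  refine Finset.sum_congr rfl fun k _ => Finset.sum_congr rfl fun l _ => ?_
  split_ifs <;> simp

lemma const_mul (h : PairSeries D) {c : ℂ} (hc : ∀ v ∈ depthTwo, c * v ∈ depthTwo) :
    PairSeries fun k l => c * D k l := by
  obtain ⟨v, hv, h⟩ := h
  refine ⟨c * v, hc v hv, (h.const_mul c).congr fun N => ?_⟩
  simp only [Finset.mul_sum, mul_ite, mul_zero]

lemma swap (h : PairSeries D) : PairSeries fun k l => D l k := by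
  obtain ⟨v, hv, h⟩ := h
  refine ⟨v, hv, h.congr fun N => ?_⟩
  rw [Finset.sum_comm]
  simp only [eq_comm]

end PairSeries

lemma rat_mul_mem_depthTwo (c : ℚ) : ∀ v ∈ depthTwo, (c : ℂ) * v ∈ depthTwo := fun v hv => by
  rw [← Rat.smul_def]; exact Submodule.smul_mem _ _ hv

lemma sign_mul_mem_depthTwo (a : ℕ) : ∀ v ∈ depthTwo, (-1 : ℂ) ^ a * v ∈ depthTwo := by
  simpa using rat_mul_mem_depthTwo ((-1) ^ a)

lemma neg_one_mul_mem_depthTwo : ∀ v ∈ depthTwo, (-1 : ℂ) * v ∈ depthTwo := by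
  simp

/-- The sum over a square is a product of two single sums, minus the diagonal. -/
lemma pairSeries_mono_mul_mono {a b : ℕ} {X Y : ℂ} (ha : Nondeg a X) (hb : Nondeg b Y) :
    PairSeries fun k l => mono a X k * mono b Y l := by
  obtain ⟨v, hv, h1⟩ := pos_mono_mem ha
  obtain ⟨w, hw, h2⟩ := pos_mono_mem hb
  have hab : 2 ≤ a + b := by have := ha.one_le; have := hb.one_le; omega
  obtain ⟨d, hd, h3⟩ := pos_mono_mem (Nondeg.of_two_le hab (ha.fin.mul hb.fin))
  refine ⟨v * w - d, sub_mem (mul_mem_rationalCombinationsOfProducts hv hw) hd, ?_⟩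
  have := (((h1.tendsto.comp (tendsto_add_atTop_nat 1)).mul
    (h2.tendsto.comp (tendsto_add_atTop_nat 1))).sub
      (h3.tendsto.comp (tendsto_add_atTop_nat 1)))
  refine this.congr fun N => ?_
  simp only [Function.comp]
  rw [← sum_Icc_eq_psum (mono_zero ha.one_le X), ← sum_Icc_eq_psum (mono_zero hb.one_le Y),
    ← sum_Icc_eq_psum (mono_zero (by omega) _), Finset.sum_mul, ← Finset.sum_sub_distrib]
  refine Finset.sum_congr rfl fun k hk => ?_
  rw [Finset.mul_sum, ← Finset.add_sum_erase _ _ hk, ← Finset.add_sum_erase _ (fun l => ite _ _ _) hk,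
    if_pos rfl, zero_add]
  have : pos (mono a X) k * pos (mono b Y) k = pos (mono (a + b) (X * Y)) k := mono_mul a b k
  rw [this, add_sub_cancel_left]
  exact Finset.sum_congr rfl fun m hm => by rw [if_neg (Finset.ne_of_mem_erase hm).symm]; rfl

/-- The sum of `Ψ (l - k)` over `1 ≤ l ≤ N`. -/
noncomputable def window (Ψ : ℤ → ℂ) (N : ℕ) (k : ℤ) : ℂ := ∑ l ∈ Finset.Icc 1 N, Ψ ((l : ℤ) - k)

lemma window_zero (Ψ : ℤ → ℂ) (k : ℤ) : window Ψ 0 k = 0 := by simp [window]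

lemma window_succ (Ψ : ℤ → ℂ) (N : ℕ) (k : ℤ) :
    window Ψ (N + 1) k = window Ψ N k + Ψ ((N + 1 : ℤ) - k) := by
  rw [window, Finset.sum_Icc_succ_top (by omega), window]
  push_cast
  rfl

lemma window_neg (Ψ : ℤ → ℂ) (N j : ℕ) :
    window Ψ N (-j) = psum (pos Ψ) (N + j + 1) - psum (pos Ψ) (j + 1) := by
  induction N with
  | zero => simp [window_zero]
  | succ N ih =>
    rw [window_succ, ih, show N + 1 + j + 1 = (N + j + 1) + 1 by ring, psum_succ _ (N + j + 1)]
    simp only [pos]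
    push_cast
    rw [show (N : ℤ) + 1 - -j = N + j + 1 by ring]
    ring

lemma window_of_lt (Ψ : ℤ → ℂ) (d N : ℕ) :
    window Ψ N (d + N : ℕ) = psum (neg Ψ) (d + N) - psum (neg Ψ) d := by
  induction N generalizing d with
  | zero => simp [window_zero]
  | succ N ih =>
    have := ih (d + 1)
    rw [show d + 1 + N = d + (N + 1) by ring] at this
    rw [window_succ, this, psum_succ _ d]
    simp only [neg]
    push_cast
    rw [show (N : ℤ) + 1 - (d + (N + 1)) = -d by ring]
    ring

lemma window_add {Ψ : ℤ → ℂ} (h0 : Ψ 0 = 0) (k d : ℕ) :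
    window Ψ (k + d) k = psum (neg Ψ) k + psum (pos Ψ) (d + 1) := by
  induction d with
  | zero =>
    have := window_of_lt Ψ 0 k
    simp only [zero_add] at this
    rw [add_zero, this]
    simp [psum, pos, h0]
  | succ d ih =>
    rw [← add_assoc, window_succ, ih, psum_succ _ (d + 1)]
    simp only [pos]
    push_cast
    rw [show (k : ℤ) + d + 1 - k = d + 1 by ring]
    ring

lemma window_of_le {Ψ : ℤ → ℂ} (h0 : Ψ 0 = 0) {N k : ℕ} (hk : k ≤ N) :
    window Ψ N k = psum (neg Ψ) k + psum (pos Ψ) (N + 1 - k) := by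
  obtain ⟨d, rfl⟩ := Nat.exists_eq_add_of_le hk
  rw [window_add h0]
  congr 2
  omega

/-- Since 1/((k+1)(n-k+1)) = (1/(n+2)) (1/(k+1) + 1/(n-k+1)), the sum is bounded by a multiple of
the Cesàro mean of 1/(k+1), which tends to 0. -/
lemma tendsto_convolution {a b : ℕ → ℝ} {A B : ℝ} (ha0 : ∀ n, 0 ≤ a n) (hb0 : ∀ n, 0 ≤ b n)
    (ha : ∀ n : ℕ, a n ≤ A / (n + 1)) (hb : ∀ n : ℕ, b n ≤ B / (n + 1)) :
    Tendsto (fun n => ∑ k ∈ Finset.range (n + 1), a k * b (n - k)) atTop (𝓝 0) := by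
  have hA : 0 ≤ A := by simpa using (ha0 0).trans (ha 0)
  have hB : 0 ≤ B := by simpa using (hb0 0).trans (hb 0)
  have h1 : Tendsto (fun n : ℕ => A * B * 2 * (((n + 1 : ℕ) : ℝ)⁻¹ *
      ∑ k ∈ Finset.range (n + 1), 1 / ((k : ℝ) + 1))) atTop (𝓝 0) := by
    have := ((tendsto_one_div_add_atTop_nhds_zero_nat (𝕜 := ℝ)).cesaro.comp
      (tendsto_add_atTop_nat 1)).const_mul (A * B * 2)
    simpa using this
  refine squeeze_zero (fun n => Finset.sum_nonneg fun k _ => mul_nonneg (ha0 _) (hb0 _))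
    (fun n => ?_) h1
  have h2 : ∀ k ∈ Finset.range (n + 1), a k * b (n - k)
      ≤ A * B * ((n + 1 : ℕ) : ℝ)⁻¹ * (1 / ((k : ℝ) + 1) + 1 / (((n - k : ℕ) : ℝ) + 1)) := by
    intro k hk
    have hkn : k ≤ n := by rw [Finset.mem_range] at hk; omega
    refine (mul_le_mul (ha k) (hb (n - k)) (hb0 _) (by positivity)).trans ?_
    have h3 : ((n - k : ℕ) : ℝ) = n - k := by rw [Nat.cast_sub hkn]
    have h4 : (0 : ℝ) ≤ ((n - k : ℕ) : ℝ) := by positivity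
    have h5 : (n : ℝ) = k + (n - k : ℕ) := by rw [h3]; ring
    rw [div_mul_div_comm, mul_assoc (A * B), div_eq_mul_inv]
    refine mul_le_mul_of_nonneg_left ?_ (by positivity)
    push_cast
    rw [h5]
    generalize ((n - k : ℕ) : ℝ) = t at h4
    have hk0 : (0 : ℝ) ≤ k := by positivity
    rw [div_add_div _ _ (by positivity) (by positivity), ← div_eq_inv_mul, div_div, inv_eq_one_div,
      div_le_div_iff₀ (by positivity) (by positivity)]
    have : 0 ≤ ((k : ℝ) + 1) * (t + 1) := by positivity
    nlinarith
  refine (Finset.sum_le_sum h2).trans (le_of_eq ?_)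
  rw [← Finset.mul_sum, Finset.sum_add_distrib,
    Finset.sum_flip (fun k => 1 / ((k : ℝ) + 1))]
  ring

/-- For fixed k ≤ N the difference l - k runs from 1 - k to N - k. Its negative values give a nested
double series; its positive values give a partial sum, whose replacement by the full sum costs a
convolution that tends to 0. -/
lemma pairSeries_mono_mul_mono_sub {a b : ℕ} {X Y : ℂ} (ha : Nondeg a X) (hb : Nondeg b Y) :
    PairSeries fun k l => mono a X k * mono b Y ((l : ℤ) - k) := by
  obtain ⟨v, hv, h1⟩ := pos_mono_mem ha
  obtain ⟨w, hw, h2⟩ := pos_mono_mem hb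
  obtain ⟨d, hd, h3⟩ := pos_mono_mul_psum_neg_mem hb ha
  refine ⟨d + v * w, add_mem hd (mul_mem_rationalCombinationsOfProducts hv hw), ?_⟩
  obtain ⟨A, -, hA⟩ := h1.exists_norm_le
  obtain ⟨B, hB⟩ := h2
  have hconv := tendsto_convolution (fun _ => norm_nonneg _) (fun _ => norm_nonneg _) hA hB
  have h4 : Tendsto (fun N : ℕ => ∑ k ∈ Finset.Icc 1 N, pos (mono a X) k *
      (psum (pos (mono b Y)) (N + 1 - k) - w)) atTop (𝓝 0) := by
    refine squeeze_zero_norm (fun N => ?_) (hconv.comp (tendsto_add_atTop_nat 1))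
    refine (norm_sum_le _ _).trans ?_
    simp only [norm_mul]
    refine Finset.sum_le_sum_of_subset_of_nonneg (fun k hk => ?_) (fun _ _ _ => by positivity)
    simp only [Finset.mem_Icc, Finset.mem_range] at hk ⊢
    omega
  have := ((h3.tendsto.comp (tendsto_add_atTop_nat 1)).add
    ((h1.tendsto.comp (tendsto_add_atTop_nat 1)).mul_const w)).add h4
  rw [add_zero] at this
  refine this.congr fun N => ?_
  simp only [Function.comp]
  rw [← sum_Icc_eq_psum (by simp [psum_zero]), ← sum_Icc_eq_psum (mono_zero ha.one_le X),
    Finset.sum_mul, ← Finset.sum_add_distrib, ← Finset.sum_add_distrib]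
  refine Finset.sum_congr rfl fun k hk => ?_
  have h5 : (∑ l ∈ Finset.Icc 1 N, if k = l then 0 else mono a X k * mono b Y ((l : ℤ) - k))
      = mono a X k * window (mono b Y) N k := by
    rw [window, Finset.mul_sum]
    refine Finset.sum_congr rfl fun l _ => ?_
    split_ifs with h
    · subst h; simp [mono_zero hb.one_le]
    · rfl
  rw [h5, window_of_le (mono_zero hb.one_le Y) (Finset.mem_Icc.1 hk).2]
  simp only [Pi.mul_apply, pos]
  ring

/-! ### The inner sum over m for k ≠ l. -/

/-- The character `x ^ (k - m) y ^ (l - m) z ^ m`. -/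
noncomputable def character (x y z : ℂ) (k l m : ℤ) : ℂ := x ^ (k - m) * y ^ (l - m) * z ^ m

/-- The function `T` with the values at `0`, `k` and `l` replaced by zero. -/
noncomputable def punctured (k l : ℤ) (T : ℤ → ℂ) (m : ℤ) : ℂ :=
  if m = 0 then 0 else if m = k then 0 else if m = l then 0 else T m

lemma punctured_swap (k l : ℤ) (T : ℤ → ℂ) : punctured k l T = punctured l k T := by
  funext m
  unfold punctured
  split_ifs <;> rfl

lemma BiTo.punctured {T : ℤ → ℂ} {c : ℂ} (h : BiTo T c) {k l : ℤ} (hk : k ≠ 0) (hl : l ≠ 0)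
    (hkl : k ≠ l) : BiTo (punctured k l T) (c - T l - T k - T 0) := by
  have := ((h.exclude l).exclude k).exclude 0
  simp only [if_neg hkl, if_neg hk.symm, if_neg hl.symm] at this
  exact this

/-- The sums of `t 0 k l m` against the character over `m ∉ {0, k, l}` exist, and their sum over
positive `k ≠ l` lies in `depthTwo`. -/
def HasTripleSum (x y z : ℂ) (t : ℂ → ℂ → ℂ → ℂ → ℂ) : Prop :=
  ∃ D : ℕ → ℕ → ℂ, PairSeries D ∧ ∀ k l : ℕ, 1 ≤ k → 1 ≤ l → k ≠ l →
    BiTo (punctured k l fun m => t 0 k l m * character x y z k l m) (D k l)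

lemma HasTripleSum.swap {x y z : ℂ} {t : ℂ → ℂ → ℂ → ℂ → ℂ} (h : HasTripleSum x y z t) :
    HasTripleSum y x z fun α β γ s => t α γ β s := by
  obtain ⟨D, hD, h⟩ := h
  refine ⟨fun k l => D l k, hD.swap, fun k l hk hl hkl => ?_⟩
  rw [punctured_swap]
  have := h l k hl hk hkl.symm
  convert this using 3
  simp only [character]
  ring

section

variable {p q r : ℕ} {x y z : ℂ}

/-- With ζ = z/(xy) the character is x^k y^l ζ^m, so the sum over m is a bilateral depth one
constant c times a function of (k, l). The excluded points m = k and m = l merge ζ^m/m^j into the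
factor in k or in l, whose exponent then is at least 2. -/
lemma hasTripleSum_at_zero (hx : Nondeg p x) (hy : Nondeg q y) (hz : IsOfFinOrder z) {a b j : ℕ}
    (ha : p ≤ a) (hb : q ≤ b) (hj : 1 ≤ j) :
    HasTripleSum x y z fun α β γ s => ((β - α) ^ a * (γ - α) ^ b * (s - α) ^ j)⁻¹ := by
  have hxa := hx.mono_exponent ha
  have hyb := hy.mono_exponent hb
  have hx0 := hx.ne_zero
  have hy0 := hy.ne_zero
  set ζ := z * x⁻¹ * y⁻¹ with hζ
  have hζ' : IsOfFinOrder ζ := (hz.mul hx.inv.fin).mul hy.inv.fin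
  obtain ⟨c, hc, hcl⟩ := exists_biTo_mono hj hζ'
  have hxa' : Nondeg (a + j) (x * ζ) :=
    Nondeg.of_two_le (by have := hxa.one_le; omega) (hx.fin.mul hζ')
  have hyb' : Nondeg (b + j) (y * ζ) :=
    Nondeg.of_two_le (by have := hyb.one_le; omega) (hy.fin.mul hζ')
  refine ⟨fun k l => c * (mono a x k * mono b y l)
      + (-1) * (mono a x k * mono (b + j) (y * ζ) l)
      + (-1) * (mono (a + j) (x * ζ) k * mono b y l),
    (((pairSeries_mono_mul_mono hxa hyb).const_mul
        fun v hv => mul_mem_rationalCombinationsOfProducts hc hv).add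
      ((pairSeries_mono_mul_mono hxa hyb').const_mul neg_one_mul_mem_depthTwo)).add
      ((pairSeries_mono_mul_mono hxa' hyb).const_mul neg_one_mul_mem_depthTwo), ?_⟩
  intro k l hk hl hkl
  have hT : (fun m : ℤ => (((k : ℂ) - 0) ^ a * ((l : ℂ) - 0) ^ b * ((m : ℂ) - 0) ^ j)⁻¹
      * character x y z k l m) = fun m => mono a x k * mono b y l * mono j ζ m := by
    funext m
    simp only [character, mono, hζ, sub_zero, zpow_sub₀ hx0, zpow_sub₀ hy0, mul_zpow, inv_zpow,
      Int.cast_natCast]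
    ring
  have := (hcl.const_mul (mono a x k * mono b y l)).punctured (k := k) (l := l) (by omega)
    (by omega) (by exact_mod_cast hkl)
  simp only [hT]
  convert this using 1
  rw [mono_zero hj, ← mono_mul, ← mono_mul]
  ring

/-- Centred at the pole, n = m - k, the character is z^k y^(l-k) ζ^n. The excluded point m = 0
merges into the factor in k, and m = l into the factor in l - k. -/
lemma hasTripleSum_at_first (hx : IsOfFinOrder x) (hy : Nondeg q y) (hz : Nondeg r z)
    {a b j : ℕ} (ha : r ≤ a) (hb : q ≤ b) (hj : 1 ≤ j) :
    HasTripleSum x y z fun α β γ s => ((α - β) ^ a * (γ - β) ^ b * (s - β) ^ j)⁻¹ := by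
  have hza := hz.mono_exponent ha
  have hyb := hy.mono_exponent hb
  have hx0 := ne_zero_of_isOfFinOrder hx
  have hy0 := hy.ne_zero
  have hz0 := hz.ne_zero
  set ζ := z * x⁻¹ * y⁻¹ with hζ
  have hζ' : IsOfFinOrder ζ := (hz.fin.mul (isOfFinOrder_inv hx)).mul hy.inv.fin
  obtain ⟨c, hc, hcl⟩ := exists_biTo_mono hj hζ'
  have hza' : Nondeg (a + j) (z * ζ⁻¹) :=
    Nondeg.of_two_le (by have := hza.one_le; omega) (hz.fin.mul (isOfFinOrder_inv hζ'))
  have hyb' : Nondeg (b + j) (y * ζ) :=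
    Nondeg.of_two_le (by have := hyb.one_le; omega) (hy.fin.mul hζ')
  refine ⟨fun k l => (-1) ^ a * (c * (mono a z k * mono b y ((l : ℤ) - k))
      + (-1) * (mono a z k * mono (b + j) (y * ζ) ((l : ℤ) - k))
      + (-1) * ((-1) ^ j * (mono (a + j) (z * ζ⁻¹) k * mono b y ((l : ℤ) - k)))),
    (((pairSeries_mono_mul_mono_sub hza hyb).const_mul
        fun v hv => mul_mem_rationalCombinationsOfProducts hc hv).add
      ((pairSeries_mono_mul_mono_sub hza hyb').const_mul neg_one_mul_mem_depthTwo)).add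
      (((pairSeries_mono_mul_mono_sub hza' hyb).const_mul (sign_mul_mem_depthTwo j)).const_mul
        neg_one_mul_mem_depthTwo) |>.const_mul (sign_mul_mem_depthTwo a), ?_⟩
  intro k l hk hl hkl
  have h1 : ((-1 : ℂ) ^ a)⁻¹ = (-1) ^ a := by rw [← inv_pow]; norm_num
  have hT : (fun m : ℤ => (((0 : ℂ) - k) ^ a * ((l : ℂ) - k) ^ b * ((m : ℂ) - k) ^ j)⁻¹
      * character x y z k l m)
      = fun m => (-1) ^ a * (mono a z k * mono b y ((l : ℤ) - k)) * mono j ζ (m - k) := by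
    funext m
    rw [zero_sub, neg_pow]
    simp only [character, mono, hζ, zpow_sub₀ hx0, zpow_sub₀ hy0, zpow_sub₀ hz0, mul_zpow,
      inv_zpow, zpow_sub₀ (inv_ne_zero hx0), zpow_sub₀ (inv_ne_zero hy0), Int.cast_natCast,
      Int.cast_sub, mul_inv, h1]
    have hxk := zpow_ne_zero (k : ℤ) hx0
    have hyk := zpow_ne_zero (k : ℤ) hy0
    have hzk := zpow_ne_zero (k : ℤ) hz0
    simp only [div_eq_mul_inv, inv_inv]
    field_simp
  have := ((hcl.shift (tendsto_mono_cofinite hj hζ') k).const_mul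
    ((-1) ^ a * (mono a z k * mono b y ((l : ℤ) - k)))).punctured (k := k) (l := l) (by omega)
    (by omega) (by exact_mod_cast hkl)
  simp only [hT]
  convert this using 1
  rw [sub_self, zero_sub, mono_neg, mono_zero hj, ← mono_mul, ← mono_mul]
  ring

lemma HasTripleSum.of_mem_span (hx : Nondeg p x) (hy : Nondeg q y) (hz : Nondeg r z)
    {t : ℂ → ℂ → ℂ → ℂ → ℂ} (ht : t ∈ Submodule.span ℚ (partialFractionTerms r p q)) :
    HasTripleSum x y z t := by
  induction ht using Submodule.span_induction with
  | mem t ht =>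
    rcases ht with (⟨a, b, j, ha, hb, hj, rfl⟩ | ⟨a, b, j, ha, hb, hj, rfl⟩) |
      ⟨a, b, j, ha, hb, hj, rfl⟩
    · exact hasTripleSum_at_zero hx hy hz.fin ha hb hj
    · exact hasTripleSum_at_first hx.fin hy hz ha hb hj
    · exact (hasTripleSum_at_first hy.fin hx hz ha hb hj).swap
  | zero =>
    have h0 : PairSeries fun _ _ => 0 := ⟨0, zero_mem _, by simp⟩
    refine ⟨_, h0, fun k l _ _ _ => ?_⟩
    have : bsum (punctured k l fun m => (0 : ℂ → ℂ → ℂ → ℂ → ℂ) 0 k l m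
        * character x y z k l m) = fun _ => 0 := by
      funext M
      simp [bsum, punctured]
    rw [BiTo, this]
    exact tendsto_const_nhds
  | add t u _ _ h1 h2 =>
    obtain ⟨D, hD, h1⟩ := h1
    obtain ⟨E, hE, h2⟩ := h2
    refine ⟨_, hD.add hE, fun k l hk hl hkl => ?_⟩
    convert (h1 k l hk hl hkl).add (h2 k l hk hl hkl) using 1
    funext m
    unfold punctured
    split_ifs <;> simp [add_mul]
  | smul c t _ h1 =>
    obtain ⟨D, hD, h1⟩ := h1
    refine ⟨_, hD.const_mul (rat_mul_mem_depthTwo c), fun k l hk hl hkl => ?_⟩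
    convert (h1 k l hk hl hkl).const_mul (c : ℂ) using 1
    funext m
    unfold punctured
    split_ifs <;> simp [Rat.smul_def, mul_assoc]

lemma exists_pairSeries_triple (hx : Nondeg p x) (hy : Nondeg q y) (hz : Nondeg r z) :
    ∃ D : ℕ → ℕ → ℂ, PairSeries D ∧ ∀ k l : ℕ, 1 ≤ k → 1 ≤ l → k ≠ l →
      BiTo (fun m => mono r z m * mono p x (k - m) * mono q y (l - m)) (D k l) := by
  obtain ⟨t, ht, h⟩ := hasPartialFractions hz.one_le hx.one_le hy.one_le
  obtain ⟨D, hD, hDt⟩ := HasTripleSum.of_mem_span hx hy hz ht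
  refine ⟨_, hD.const_mul (sign_mul_mem_depthTwo (p + q)), fun k l hk hl hkl => ?_⟩
  -- The product of monomials vanishes at m = 0, k, l, so puncturing loses nothing. The sign turns m
  -- - k and m - l into k - m and l - m.
  convert (hDt k l hk hl hkl).const_mul ((-1) ^ (p + q)) using 1
  funext m
  unfold punctured
  split_ifs with h1 h2 h3
  · subst h1; simp [mono_zero hz.one_le]
  · subst h2; simp [mono_zero hx.one_le]
  · subst h3; simp [mono_zero hy.one_le]
  · have hD : Distinct 0 k l m := by
      refine ⟨?_, ?_, ?_, ?_, ?_, ?_⟩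
      · exact_mod_cast (by omega : 0 ≠ k)
      · exact_mod_cast (by omega : 0 ≠ l)
      · exact_mod_cast (Ne.symm h1)
      · exact_mod_cast hkl
      · exact_mod_cast (Ne.symm h2)
      · exact_mod_cast (Ne.symm h3)
    have hs : ∀ n : ℕ, ((-1 : ℂ) ^ n)⁻¹ = (-1) ^ n := fun n => by rw [← inv_pow]; norm_num
    simp only [h _ _ _ _ hD]
    simp only [mono, character, Int.cast_sub, Int.cast_natCast, sub_zero]
    rw [← neg_sub (m : ℂ) k, ← neg_sub (m : ℂ) l, neg_pow, neg_pow _ q, pow_add]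
    simp only [div_eq_mul_inv, mul_inv, hs]
    ring

end

/-! ### The inner sum over m on the diagonal k = l. -/

/-- The terms of the partial fraction decomposition of `1 / (s ^ r (s - k) ^ p)`. -/
def partialFractionTermsTwo (r p : ℕ) : Set (ℂ → ℂ → ℂ) :=
  {t | ∃ a j, p ≤ a ∧ 1 ≤ j ∧ t = fun k s => (k ^ a * s ^ j)⁻¹} ∪
  {t | ∃ a j, r ≤ a ∧ 1 ≤ j ∧ t = fun k s => (k ^ a * (s - k) ^ j)⁻¹}

lemma inv_mul_mem_span {r p r' p' : ℕ} (hr : r' ≤ r + 1) (hp : p' ≤ p + 1) {t : ℂ → ℂ → ℂ}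
    (ht : t ∈ Submodule.span ℚ (partialFractionTermsTwo r p)) :
    (fun k s => k⁻¹ * t k s) ∈ Submodule.span ℚ (partialFractionTermsTwo r' p') := by
  induction ht using Submodule.span_induction with
  | mem t ht =>
    refine Submodule.subset_span ?_
    rcases ht with ⟨a, j, ha, hj, rfl⟩ | ⟨a, j, ha, hj, rfl⟩
    · refine Or.inl ⟨a + 1, j, by omega, hj, ?_⟩
      funext k s
      rw [← mul_inv, ← mul_assoc, pow_succ']
    · refine Or.inr ⟨a + 1, j, by omega, hj, ?_⟩
      funext k s
      rw [← mul_inv, ← mul_assoc, pow_succ']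
  | zero =>
    convert zero_mem (Submodule.span ℚ (partialFractionTermsTwo r' p')) using 1
    funext k s
    simp
  | add t u _ _ h1 h2 =>
    convert add_mem h1 h2 using 1
    funext k s
    simp [mul_add]
  | smul c t _ h =>
    convert Submodule.smul_mem _ c h using 1
    funext k s
    simp only [Pi.smul_apply, mul_smul_comm]

/-- Induction from 1/(s (s - k)) = k⁻¹ (1/(s - k) - 1/s): each step lowers one of the two exponents
and gains a factor k⁻¹, which preserves the bounds on the exponent of k. -/
lemma exists_partialFractionsTwo (r p : ℕ) (h : 1 ≤ r + p) :
    ∃ t ∈ Submodule.span ℚ (partialFractionTermsTwo r p), ∀ k s : ℂ, k ≠ 0 → s ≠ 0 → s ≠ k →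
      t k s = (s ^ r * (s - k) ^ p)⁻¹ := by
  induction r generalizing p with
  | zero =>
    refine ⟨_, Submodule.subset_span (Or.inr ⟨0, p, le_rfl, by omega, rfl⟩), fun k s _ _ _ => ?_⟩
    simp
  | succ r ihr =>
    induction p with
    | zero =>
      refine ⟨_, Submodule.subset_span (Or.inl ⟨0, r + 1, le_rfl, by omega, rfl⟩),
        fun k s _ _ _ => ?_⟩
      simp
    | succ p ihp =>
      obtain ⟨t, ht, h1⟩ := ihr (p + 1) (by omega)
      obtain ⟨u, hu, h2⟩ := ihp (by omega)
      refine ⟨_, sub_mem (inv_mul_mem_span (r' := r + 1) (p' := p + 1) le_rfl (by omega) ht)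
        (inv_mul_mem_span (r' := r + 1) (p' := p + 1) (by omega) le_rfl hu), ?_⟩
      intro k s hk hs hsk
      have := sub_ne_zero.2 hsk
      simp only [Pi.sub_apply]
      rw [h1 k s hk hs hsk, h2 k s hk hs hsk]
      field_simp
      ring

/-- The sums of `t k m` against the character over `m ∉ {0, k}` exist, and their sum over
positive `k` lies in `depthTwo`. -/
def HasDoubleSum (X z : ℂ) (t : ℂ → ℂ → ℂ) : Prop :=
  ∃ D ∈ depthTwoSeries, D 0 = 0 ∧ ∀ k : ℕ, 1 ≤ k →
    BiTo (fun m => if m = 0 then 0 else if m = k then 0 else t k m * (X ^ (k - m) * z ^ m)) (D k)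

section

variable {s r : ℕ} {X z : ℂ}

lemma hasDoubleSum_at_zero (hX : Nondeg s X) (hz : IsOfFinOrder z) {a j : ℕ} (ha : s ≤ a)
    (hj : 1 ≤ j) : HasDoubleSum X z fun k m => (k ^ a * m ^ j)⁻¹ := by
  have hXa := hX.mono_exponent ha
  have hX0 := hX.ne_zero
  set ζ := z * X⁻¹ with hζ
  have hζ' : IsOfFinOrder ζ := hz.mul hX.inv.fin
  obtain ⟨c, hc, hcl⟩ := exists_biTo_mono hj hζ'
  have h2 : Nondeg (a + j) (X * ζ) :=
    Nondeg.of_two_le (by have := hXa.one_le; omega) (hX.fin.mul hζ')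
  refine ⟨(fun k => c * pos (mono a X) k) - pos (mono (a + j) (X * ζ)),
    sub_mem (const_mul_mem_depthTwoSeries (pos_mono_mem hXa) hc) (pos_mono_mem h2),
    by simp [pos, mono_zero hXa.one_le, mono_zero h2.one_le], fun k hk => ?_⟩
  have hT : ∀ m : ℤ, ((k : ℂ) ^ a * (m : ℂ) ^ j)⁻¹ * (X ^ ((k : ℤ) - m) * z ^ m)
      = mono a X k * mono j ζ m := by
    intro m
    simp only [mono, hζ, zpow_sub₀ hX0, mul_zpow, inv_zpow, Int.cast_natCast]
    ring
  have := ((hcl.const_mul (mono a X k)).exclude k).exclude 0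
  rw [if_neg (by omega)] at this
  simp only [hT]
  convert this using 1
  simp only [Pi.sub_apply, pos]
  rw [mono_zero hj, ← mono_mul]
  ring

lemma hasDoubleSum_at_first (hX : IsOfFinOrder X) (hz : Nondeg r z) {a j : ℕ} (ha : r ≤ a)
    (hj : 1 ≤ j) : HasDoubleSum X z fun k m => (k ^ a * (m - k) ^ j)⁻¹ := by
  have hza := hz.mono_exponent ha
  have hX0 := ne_zero_of_isOfFinOrder hX
  have hz0 := hz.ne_zero
  set ζ := z * X⁻¹ with hζ
  have hζ' : IsOfFinOrder ζ := hz.fin.mul (isOfFinOrder_inv hX)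
  obtain ⟨c, hc, hcl⟩ := exists_biTo_mono hj hζ'
  have h2 : Nondeg (a + j) (z * ζ⁻¹) :=
    Nondeg.of_two_le (by have := hza.one_le; omega) (hz.fin.mul (isOfFinOrder_inv hζ'))
  refine ⟨(fun k => c * pos (mono a z) k) - fun k => (-1) ^ j * pos (mono (a + j) (z * ζ⁻¹)) k,
    sub_mem (const_mul_mem_depthTwoSeries (pos_mono_mem hza) hc)
      (sign_mul_mem_depthTwoSeries (pos_mono_mem h2) j),
    by simp [pos, mono_zero hza.one_le, mono_zero h2.one_le], fun k hk => ?_⟩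
  have hT : ∀ m : ℤ, ((k : ℂ) ^ a * ((m : ℂ) - k) ^ j)⁻¹ * (X ^ ((k : ℤ) - m) * z ^ m)
      = mono a z k * mono j ζ (m - k) := by
    intro m
    simp only [mono, hζ, zpow_sub₀ hX0, zpow_sub₀ hz0, mul_zpow, inv_zpow,
      zpow_sub₀ (inv_ne_zero hX0), Int.cast_natCast, Int.cast_sub]
    have hXk := zpow_ne_zero (k : ℤ) hX0
    have hzk := zpow_ne_zero (k : ℤ) hz0
    simp only [div_eq_mul_inv, inv_inv]
    field_simp
  have := (((hcl.shift (tendsto_mono_cofinite hj hζ') k).const_mul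
    (mono a z k)).exclude k).exclude 0
  rw [if_neg (by omega)] at this
  simp only [hT]
  convert this using 1
  simp only [Pi.sub_apply, pos]
  rw [sub_self, zero_sub, mono_neg, mono_zero hj, ← mono_mul]
  ring

lemma HasDoubleSum.of_mem_span (hX : Nondeg s X) (hz : Nondeg r z) {t : ℂ → ℂ → ℂ}
    (ht : t ∈ Submodule.span ℚ (partialFractionTermsTwo r s)) : HasDoubleSum X z t := by
  induction ht using Submodule.span_induction with
  | mem t ht =>
    rcases ht with ⟨a, j, ha, hj, rfl⟩ | ⟨a, j, ha, hj, rfl⟩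
    · exact hasDoubleSum_at_zero hX hz.fin ha hj
    · exact hasDoubleSum_at_first hX.fin hz ha hj
  | zero =>
    refine ⟨0, zero_mem _, rfl, fun k _ => ?_⟩
    have : bsum (fun m => if m = 0 then 0 else if m = k then 0 else
        (0 : ℂ → ℂ → ℂ) k m * (X ^ (k - m) * z ^ m)) = fun _ => 0 := by
      funext M
      simp [bsum]
    rw [BiTo, this]
    exact tendsto_const_nhds
  | add t u _ _ h1 h2 =>
    obtain ⟨D, hD, hD0, h1⟩ := h1
    obtain ⟨E, hE, hE0, h2⟩ := h2
    refine ⟨_, add_mem hD hE, by simp [hD0, hE0], fun k hk => ?_⟩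
    convert (h1 k hk).add (h2 k hk) using 1
    · funext m
      split_ifs <;> simp [add_mul]
    · rfl
  | smul c t _ h1 =>
    obtain ⟨D, hD, hD0, h1⟩ := h1
    refine ⟨_, Submodule.smul_mem _ c hD, by simp [hD0], fun k hk => ?_⟩
    convert (h1 k hk).const_mul (c : ℂ) using 1
    · funext m
      split_ifs <;> simp [Rat.smul_def, mul_assoc]
    · simp [Rat.smul_def]

lemma exists_series_double (hX : Nondeg s X) (hz : Nondeg r z) :
    ∃ D ∈ depthTwoSeries, D 0 = 0 ∧ ∀ k : ℕ, 1 ≤ k →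
      BiTo (fun m => mono r z m * mono s X (k - m)) (D k) := by
  obtain ⟨t, ht, h⟩ := exists_partialFractionsTwo r s (by have := hz.one_le; omega)
  obtain ⟨D, hD, hD0, hDt⟩ := HasDoubleSum.of_mem_span hX hz ht
  refine ⟨_, sign_mul_mem_depthTwoSeries hD s, by simp [hD0], fun k hk => ?_⟩
  convert (hDt k hk).const_mul ((-1) ^ s) using 1
  funext m
  split_ifs with h1 h2
  · subst h1; simp [mono_zero hz.one_le]
  · subst h2; simp [mono_zero hX.one_le]
  · have hs : ∀ n : ℕ, ((-1 : ℂ) ^ n)⁻¹ = (-1) ^ n := fun n => by rw [← inv_pow]; norm_num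
    rw [h _ _ (by exact_mod_cast (by omega : k ≠ 0)) (by exact_mod_cast h1)
      (by exact_mod_cast h2)]
    simp only [mono, Int.cast_sub, Int.cast_natCast]
    rw [← neg_sub (m : ℂ) k, neg_pow]
    simp only [div_eq_mul_inv, mul_inv, hs]
    ring

end

/-- The double sum over `1 ≤ k, l ≤ N` of the sums over all integers `m` converges to an element
of `depthTwo`. -/
lemma exists_tendsto_window_sum {p q r : ℕ} {x y z : ℂ} (hx : Nondeg p x) (hy : Nondeg q y)
    (hz : Nondeg r z) : ∃ R : ℕ → ℂ, ∃ v ∈ depthTwo, Tendsto R atTop (𝓝 v) ∧ ∀ N : ℕ,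
      BiTo (fun m => mono r z m * window (mono p x) N m * window (mono q y) N m) (R N) := by
  obtain ⟨D, ⟨v, hv, hDv⟩, hD⟩ := exists_pairSeries_triple hx hy hz
  have hpq : 2 ≤ p + q := by have := hx.one_le; have := hy.one_le; omega
  obtain ⟨E, ⟨w, hw, hEw⟩, hE0, hE⟩ :=
    exists_series_double (Nondeg.of_two_le hpq (hx.fin.mul hy.fin)) hz
  refine ⟨fun N => ∑ k ∈ Finset.Icc 1 N, ∑ l ∈ Finset.Icc 1 N, if k = l then E k else D k l,
    v + w, add_mem hv hw, ?_, fun N => ?_⟩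
  · refine (hDv.add (hEw.tendsto.comp (tendsto_add_atTop_nat 1))).congr fun N => ?_
    simp only [Function.comp]
    rw [← sum_Icc_eq_psum hE0, ← Finset.sum_add_distrib]
    refine Finset.sum_congr rfl fun k hk => ?_
    rw [← Finset.add_sum_erase _ _ hk, ← Finset.add_sum_erase _ (fun l => ite _ (E k) _) hk,
      if_pos rfl, if_pos rfl, zero_add, add_comm]
    congr 1
    refine Finset.sum_congr rfl fun l hl => ?_
    rw [if_neg (Finset.ne_of_mem_erase hl).symm, if_neg (Finset.ne_of_mem_erase hl).symm]
  · have : (fun m => mono r z m * window (mono p x) N m * window (mono q y) N m)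
        = fun m => ∑ k ∈ Finset.Icc 1 N, ∑ l ∈ Finset.Icc 1 N,
          mono r z m * mono p x (k - m) * mono q y (l - m) := by
      funext m
      rw [window, window, mul_assoc, Finset.sum_mul_sum, Finset.mul_sum]
      refine Finset.sum_congr rfl fun k _ => ?_
      rw [Finset.mul_sum]
      simp only [mul_assoc]
    rw [this]
    refine BiTo.sum fun k hk => BiTo.sum fun l hl => ?_
    -- On the diagonal the factors in k - m and l - m merge into one, with exponent p + q and
    -- argument xy.
    split_ifs with hkl
    · subst hkl
      simp only [mul_assoc, mono_mul]
      exact hE k (Finset.mem_Icc.1 hk).1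
    · exact hD k l (Finset.mem_Icc.1 hk).1 (Finset.mem_Icc.1 hl).1 hkl

/-! ### Exchanging the limits over the windows and over m. -/

lemma sum_inv_sq_le (n : ℕ) : ∑ i ∈ Finset.range n, 1 / ((i : ℝ) + 1) ^ 2 ≤ 2 := by
  have key : ∑ i ∈ Finset.range n, 1 / ((i : ℝ) + 1) ^ 2 ≤ 2 - 2 * (1 / ((n : ℝ) + 1)) := by
    induction n with
    | zero => norm_num
    | succ n ih =>
      have h0 : (0 : ℝ) ≤ n := n.cast_nonneg
      have : 1 / ((n : ℝ) + 1) ^ 2 ≤ 2 * (1 / ((n : ℝ) + 1)) - 2 * (1 / (n + 1 + 1)) := by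
        rw [← mul_sub, div_sub_div _ _ (by positivity) (by positivity), mul_div_assoc',
          div_le_div_iff₀ (by positivity) (by positivity)]
        nlinarith
      rw [Finset.sum_range_succ]
      push_cast
      linarith
  have : (0 : ℝ) ≤ 1 / ((n : ℝ) + 1) := by positivity
  linarith

lemma norm_psum_add_sub_le {f : ℕ → ℂ} {A : ℝ} {n d : ℕ} (hA : 0 ≤ A)
    (h : ∀ i < d, ‖f (n + i)‖ ≤ A * (1 / ((i : ℝ) + 1) ^ 2)) :
    ‖psum f (n + d) - psum f n‖ ≤ 2 * A := by
  have h1 : psum f (n + d) - psum f n = ∑ i ∈ Finset.range d, f (n + i) := by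
    simp [psum, Finset.sum_range_add]
  rw [h1]
  refine (norm_sum_le _ _).trans ?_
  refine (Finset.sum_le_sum fun i hi => h i (Finset.mem_range.1 hi)).trans ?_
  rw [← Finset.mul_sum, mul_comm]
  exact mul_le_mul_of_nonneg_right (sum_inv_sq_le d) hA

lemma RapidTo.exists_norm_sub_le {u : ℕ → ℂ} {L : ℂ} (h : RapidTo u L) :
    ∃ C : ℝ, 0 ≤ C ∧ ∀ a b : ℕ, b ≤ a → ‖u a - u b‖ ≤ C / (b + 1) := by
  obtain ⟨C, hC0, hC⟩ := h.exists_pos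
  refine ⟨2 * C, by positivity, fun a b hab => ?_⟩
  have h2 : C / ((a : ℝ) + 1) ≤ C / ((b : ℝ) + 1) := by gcongr
  calc ‖u a - u b‖ = ‖(u a - L) - (u b - L)‖ := by congr 1; ring
    _ ≤ ‖u a - L‖ + ‖u b - L‖ := norm_sub_le _ _
    _ ≤ C / (b + 1) + C / (b + 1) := add_le_add ((hC _).trans h2) (hC b)
    _ = 2 * C / (b + 1) := by ring

section

variable {f g h : ℤ → ℂ} {a b c a' b' c' : ℂ}

/-- The range 0 ≤ m ≤ N. Each window differs from its limit by O(1/(N+2-m)) and h m is O(1/(m+1)),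
so the total error is a convolution. -/
lemma tendsto_window_inner (f0 : f 0 = 0) (g0 : g 0 = 0) (hf : TameSum (pos f) a)
    (hg : TameSum (pos g) b) (hf' : TameSum (neg f) a') (hg' : TameSum (neg g) b')
    (hh : TameSum (pos h) c) :
    Tendsto (fun N => ∑ m ∈ Finset.range (N + 1), (h m * window f N m * window g N m -
      h m * ((psum (neg f) m + a) * (psum (neg g) m + b)))) atTop (𝓝 0) := by
  obtain ⟨Ch, -, hCh⟩ := hh.exists_norm_le
  obtain ⟨Cf, -, hCf⟩ := RapidTo.exists_pos hf
  obtain ⟨Cg, -, hCg⟩ := RapidTo.exists_pos hg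
  obtain ⟨B1, hB10, hB1⟩ := RapidTo.exists_norm_le hf'
  obtain ⟨B2, hB20, hB2⟩ := RapidTo.exists_norm_le hg'
  obtain ⟨B3, hB30, hB3⟩ := RapidTo.exists_norm_le hg
  have hcf := tendsto_convolution (fun _ => norm_nonneg _) (fun _ => norm_nonneg _) hCh hCf
  have hcg := tendsto_convolution (fun _ => norm_nonneg _) (fun _ => norm_nonneg _) hCh hCg
  have hlim := ((hcf.const_mul (B2 + B3)).add (hcg.const_mul (B1 + ‖a‖))).comp
    (tendsto_add_atTop_nat 1)
  rw [mul_zero, mul_zero, add_zero] at hlim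
  refine squeeze_zero_norm (fun N => ?_) hlim
  simp only [Function.comp, Finset.mul_sum, ← Finset.sum_add_distrib]
  refine (norm_sum_le _ _).trans ?_
  refine (Finset.sum_le_sum (g := fun m => (B2 + B3) * (‖pos h m‖ * ‖psum (pos f) (N + 1 - m) - a‖)
    + (B1 + ‖a‖) * (‖pos h m‖ * ‖psum (pos g) (N + 1 - m) - b‖)) fun m hm => ?_).trans
    (Finset.sum_le_sum_of_subset_of_nonneg (Finset.range_mono (by omega))
      fun _ _ _ => by positivity)
  have hmN : m ≤ N := by rw [Finset.mem_range] at hm; omega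
  rw [window_of_le f0 hmN, window_of_le g0 hmN]
  set v := psum (pos f) (N + 1 - m)
  set v' := psum (pos g) (N + 1 - m) with hv'
  have : h m * (psum (neg f) m + v) * (psum (neg g) m + v')
      - h m * ((psum (neg f) m + a) * (psum (neg g) m + b))
      = (psum (neg g) m + v') * (pos h m * (v - a)) + (psum (neg f) m + a) * (pos h m * (v' - b)) := by
    simp only [pos]; ring
  rw [this]
  refine (norm_add_le _ _).trans (add_le_add ?_ ?_)
  · rw [norm_mul, norm_mul]
    gcongr
    exact (norm_add_le _ _).trans (add_le_add (hB2 m) (hB3 _))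
  · rw [norm_mul, norm_mul]
    gcongr
    exact (norm_add_le _ _).trans (add_le_add (hB1 m) le_rfl)

/-- The range m > N. With m = N + 1 + i both windows are O(1/(i+1)), so the terms are O(1/N) times a
summable 1/(i+1)². -/
lemma exists_norm_window_outer_le (hf : TameSum (neg f) a) (hg : TameSum (neg g) b)
    (hh : TameSum (pos h) c) : ∃ C : ℝ, ∀ N M : ℕ, N ≤ M →
      ‖psum (pos fun m => h m * window f N m * window g N m) (M + 1)
        - psum (pos fun m => h m * window f N m * window g N m) (N + 1)‖ ≤ C / (N + 1) := by
  obtain ⟨Ch, hCh0, hCh⟩ := hh.exists_norm_le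
  obtain ⟨Cf, hCf0, hCf⟩ := RapidTo.exists_norm_sub_le hf
  obtain ⟨Cg, hCg0, hCg⟩ := RapidTo.exists_norm_sub_le hg
  refine ⟨2 * (Ch * Cf * Cg), fun N M hNM => ?_⟩
  obtain ⟨d, rfl⟩ := Nat.exists_eq_add_of_le hNM
  rw [show N + d + 1 = N + 1 + d by ring, mul_div_assoc]
  refine norm_psum_add_sub_le (by positivity) fun i _ => ?_
  have hw : ∀ φ : ℤ → ℂ, window φ N (N + 1 + i : ℕ)
      = psum (neg φ) (i + 1 + N) - psum (neg φ) (i + 1) := fun φ => by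
    rw [← window_of_lt, show i + 1 + N = N + 1 + i by ring]
  have h1 : ‖h (N + 1 + i : ℕ)‖ ≤ Ch / (N + 1) := by
    refine (hCh (N + 1 + i)).trans ?_
    gcongr
    linarith
  have h2 : ∀ C : ℝ, 0 ≤ C → C / ((i + 1 : ℕ) + 1) ≤ C / ((i : ℝ) + 1) := fun C hC => by
    push_cast; gcongr; linarith
  simp only [pos, hw, norm_mul]
  calc _ ≤ Ch / (N + 1) * (Cf / (i + 1)) * (Cg / (i + 1)) := by
        gcongr
        · exact (hCf _ _ (by omega)).trans (h2 _ hCf0)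
        · exact (hCg _ _ (by omega)).trans (h2 _ hCg0)
    _ = _ := by field_simp

/-- The nonpositive range m = -j. For j ≤ N each term is compared with its limit; for j > N the
terms themselves are negligible. The bound is uniform in M. -/
lemma exists_norm_window_neg_le (hf : TameSum (pos f) a) (hg : TameSum (pos g) b)
    (hh : TameSum (neg h) c) : ∃ C : ℝ, ∀ N M : ℕ, N ≤ M →
      ‖psum (neg fun m => h m * window f N m * window g N m) (M + 1)
        - psum (fun j => neg h j * ((a - psum (pos f) (j + 1)) * (b - psum (pos g) (j + 1))))
          (N + 1)‖ ≤ C / (N + 1) := by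
  obtain ⟨Ch, hCh0, hCh⟩ := hh.exists_norm_le
  obtain ⟨Cf, hCf0, hCf⟩ := RapidTo.exists_norm_sub_le hf
  obtain ⟨Cg, hCg0, hCg⟩ := RapidTo.exists_norm_sub_le hg
  obtain ⟨Df, hDf0, hDf⟩ := RapidTo.exists_pos hf
  obtain ⟨Dg, hDg0, hDg⟩ := RapidTo.exists_pos hg
  refine ⟨2 * (Ch * (Df * Dg + Cf * Dg)) + 2 * (Ch * Cf * Cg), fun N M hNM => ?_⟩
  obtain ⟨d, rfl⟩ := Nat.exists_eq_add_of_le hNM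
  set H := neg fun m => h m * window f N m * window g N m with hH
  set Θ := fun j => neg h j * ((a - psum (pos f) (j + 1)) * (b - psum (pos g) (j + 1))) with hΘ
  have hHj : ∀ j, H j = neg h j * (psum (pos f) (N + j + 1) - psum (pos f) (j + 1))
      * (psum (pos g) (N + j + 1) - psum (pos g) (j + 1)) := fun j => by
    simp only [hH, neg, window_neg]
  have h2 : ∀ C : ℝ, 0 ≤ C → ∀ i : ℕ, C / ((i + 1 : ℕ) + 1) ≤ C / ((i : ℝ) + 1) :=
    fun C hC i => by push_cast; gcongr; linarith
  have hd : psum H (N + d + 1) - psum Θ (N + 1)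
      = (psum (H - Θ) (0 + (N + 1)) - psum (H - Θ) 0) + (psum H (N + 1 + d) - psum H (N + 1)) := by
    rw [psum_zero, zero_add, show N + 1 + d = N + d + 1 by ring,
      show psum (H - Θ) (N + 1) = psum H (N + 1) - psum Θ (N + 1) by
        simp [psum, Finset.sum_sub_distrib]]
    ring
  rw [hd, add_div, mul_div_assoc 2 (Ch * (Df * Dg + Cf * Dg)), mul_div_assoc 2 (Ch * Cf * Cg)]
  refine (norm_add_le _ _).trans (add_le_add ?_ ?_)
  · refine norm_psum_add_sub_le (by positivity) fun j _ => ?_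
    rw [zero_add, Pi.sub_apply, hHj]
    set v := psum (pos f) (j + 1)
    set v' := psum (pos g) (j + 1)
    set V := psum (pos f) (N + j + 1)
    set V' := psum (pos g) (N + j + 1)
    have e : neg h j * (V - v) * (V' - v') - Θ j
        = neg h j * ((V - a) * -(v' - b) + (V - v) * (V' - b)) := by
      simp only [hΘ]; ring
    have big : ∀ C : ℝ, 0 ≤ C → C / ((N + j + 1 : ℕ) + 1) ≤ C / ((N : ℝ) + 1) := fun C hC => by
      push_cast; gcongr; linarith
    rw [e, norm_mul]
    calc _ ≤ Ch / (j + 1) * (Df / (N + 1) * (Dg / (j + 1)) + Cf / (j + 1) * (Dg / (N + 1))) := by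
          refine mul_le_mul (hCh j) ((norm_add_le _ _).trans (add_le_add ?_ ?_)) (norm_nonneg _)
            (by positivity)
          · rw [norm_mul, norm_neg]
            exact mul_le_mul ((hDf _).trans (big _ hDf0)) ((hDg _).trans (h2 _ hDg0 j))
              (norm_nonneg _) (by positivity)
          · rw [norm_mul]
            exact mul_le_mul ((hCf _ _ (by omega)).trans (h2 _ hCf0 j))
              ((hDg _).trans (big _ hDg0)) (norm_nonneg _) (by positivity)
      _ = _ := by field_simp
  · refine norm_psum_add_sub_le (by positivity) fun i _ => ?_
    rw [hHj, norm_mul, norm_mul]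
    have h1 : ‖neg h (N + 1 + i)‖ ≤ Ch / (N + 1) := by
      refine (hCh (N + 1 + i)).trans ?_
      push_cast
      gcongr
      linarith
    have h3 : ∀ C : ℝ, 0 ≤ C → C / ((N + 1 + i + 1 : ℕ) + 1) ≤ C / ((i : ℝ) + 1) := fun C hC => by
      push_cast; gcongr; linarith
    calc _ ≤ Ch / (N + 1) * (Cf / (i + 1)) * (Cg / (i + 1)) := by
          gcongr
          · exact (hCf _ _ (by omega)).trans (h3 _ hCf0)
          · exact (hCg _ _ (by omega)).trans (h3 _ hCg0)
      _ = _ := by field_simp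

/-- The iterated limit of the windowed sums equals the sum of the limits of the windows. -/
lemma tendsto_psum_of_window (f0 : f 0 = 0) (g0 : g 0 = 0) (h0 : h 0 = 0)
    (hf : TameSum (pos f) a) (hg : TameSum (pos g) b) (hf' : TameSum (neg f) a')
    (hg' : TameSum (neg g) b') (hh : TameSum (pos h) c) (hh' : TameSum (neg h) c')
    {R : ℕ → ℂ} {v : ℂ} (hR : Tendsto R atTop (𝓝 v))
    (hRN : ∀ N, BiTo (fun m => h m * window f N m * window g N m) (R N)) :
    Tendsto (psum fun n => pos h n * ((psum (neg f) n + a) * (psum (neg g) n + b))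
      + neg h n * ((a - psum (pos f) (n + 1)) * (b - psum (pos g) (n + 1)))) atTop (𝓝 v) := by
  have h1 := tendsto_window_inner f0 g0 hf hg hf' hg' hh
  obtain ⟨C, hC⟩ := exists_norm_window_outer_le hf' hg' hh
  obtain ⟨D, hD⟩ := exists_norm_window_neg_le hf hg hh'
  set Θ₁ : ℕ → ℂ := fun n => pos h n * ((psum (neg f) n + a) * (psum (neg g) n + b)) with hΘ₁
  set Θ₂ : ℕ → ℂ := fun n => neg h n * ((a - psum (pos f) (n + 1)) * (b - psum (pos g) (n + 1)))
    with hΘ₂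
  -- Here N is fixed and the cutoff M of the bilateral sum tends to infinity; the window bounds do
  -- not depend on M.
  have key : ∀ N, ‖R N - psum (Θ₁ + Θ₂) (N + 1)‖ ≤
      ‖∑ m ∈ Finset.range (N + 1), (h m * window f N m * window g N m -
        h m * ((psum (neg f) m + a) * (psum (neg g) m + b)))‖ + (C + D) / (N + 1) := by
    intro N
    refine le_of_tendsto ((hRN N).sub_const _).norm ?_
    filter_upwards [eventually_ge_atTop N] with M hM
    set H : ℤ → ℂ := fun m => h m * window f N m * window g N m with hH
    have e : bsum H M - psum (Θ₁ + Θ₂) (N + 1)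
        = (psum (pos H) (N + 1) - psum Θ₁ (N + 1))
          + ((psum (pos H) (M + 1) - psum (pos H) (N + 1))
            + (psum (neg H) (M + 1) - psum Θ₂ (N + 1))) := by
      rw [bsum_eq_psum, psum_add, show H 0 = 0 by simp [hH, h0]]
      ring
    rw [e, add_div]
    refine (norm_add_le _ _).trans (add_le_add (le_of_eq ?_)
      ((norm_add_le _ _).trans (add_le_add (hC N M hM) (hD N M hM))))
    rw [psum, psum, ← Finset.sum_sub_distrib]
    rfl
  have hz : Tendsto (fun N : ℕ => (C + D) / ((N : ℝ) + 1)) atTop (𝓝 0) := by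
    have := (tendsto_one_div_add_atTop_nhds_zero_nat (𝕜 := ℝ)).const_mul (C + D)
    simpa [div_eq_mul_inv] using this
  have h2 := squeeze_zero_norm key (by simpa using h1.norm.add hz)
  have h3 := hR.sub h2
  rw [sub_zero] at h3
  rw [← tendsto_add_atTop_iff_nat 1]
  refine h3.congr fun N => ?_
  rw [sub_sub_cancel]
  rfl

end

/-! ### The parity theorem in depth three. -/

section

variable {p q r : ℕ} {x y z : ℂ}

lemma neg_mono_mul_pos_mono (hx : Nondeg p x) (hz : Nondeg r z) :
    ∃ X, Nondeg (r + p) X ∧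
      neg (mono r z) * pos (mono p x) = fun n => (-1) ^ r * pos (mono (r + p) X) n := by
  refine ⟨z⁻¹ * x, Nondeg.of_two_le (by have := hx.one_le; have := hz.one_le; omega)
    (hz.inv.fin.mul hx.fin), ?_⟩
  rw [← pos_mono_mul, neg_mono]
  funext n
  simp only [Pi.mul_apply]
  ring

lemma cross_series_mem (hx : Nondeg p x) (hy : Nondeg q y) (hz : Nondeg r z) :
    pos (mono r z) * psum (neg (mono p x)) * psum (neg (mono q y))
      + neg (mono r z) * psum (pos (mono p x)) * psum (pos (mono q y)) ∈ depthTwoSeries := by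
  obtain ⟨R, v, hv, hR, hRN⟩ := exists_tendsto_window_sum hx hy hz
  obtain ⟨a, ha, hf⟩ := pos_mono_mem hx
  obtain ⟨b, hb, hg⟩ := pos_mono_mem hy
  obtain ⟨c, -, hh⟩ := pos_mono_mem hz
  obtain ⟨a', -, hf'⟩ := neg_mono_mem hx
  obtain ⟨b', -, hg'⟩ := neg_mono_mem hy
  obtain ⟨c', -, hh'⟩ := neg_mono_mem hz
  have hlim := tendsto_psum_of_window (mono_zero hx.one_le x) (mono_zero hy.one_le y)
    (mono_zero hz.one_le z) hf hg hf' hg' hh hh' hR hRN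
  -- The tails of the series are controlled directly here; `hlim` only identifies its sum.
  obtain ⟨L₁, h₁⟩ := hh.mul_rapid
    ((RapidTo.add hf' (RapidTo.const a)).mul (RapidTo.add hg' (RapidTo.const b)))
  obtain ⟨L₂, h₂⟩ := hh'.mul_rapid
    ((RapidTo.add (RapidTo.const a) (RapidTo.const_mul (-1) (RapidTo.shift hf))).mul
      (RapidTo.add (RapidTo.const b) (RapidTo.const_mul (-1) (RapidTo.shift hg))))
  have hΘ := mem_depthTwoSeries_of_tendsto (h₁.add h₂) hv (hlim.congr fun N => by
    congr 1
    funext n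
    simp only [Pi.add_apply, Pi.mul_apply]
    ring)
  have hab := mul_mem_rationalCombinationsOfProducts ha hb
  obtain ⟨X, hX, hfX⟩ := neg_mono_mul_pos_mono hx hz
  obtain ⟨Y, hY, hgY⟩ := neg_mono_mul_pos_mono hy hz
  have m1 := const_mul_mem_depthTwoSeries (pos_mono_mul_psum_neg_mem hx hz) hb
  have m2 := const_mul_mem_depthTwoSeries (pos_mono_mul_psum_neg_mem hy hz) ha
  have m3 := const_mul_mem_depthTwoSeries (pos_mono_mem hz) hab
  have m4 := const_mul_mem_depthTwoSeries (neg_mono_mem hz) hab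
  have m5 := const_mul_mem_depthTwoSeries (neg_mono_mul_psum_pos_mem hx hz) hb
  have m6 := const_mul_mem_depthTwoSeries (neg_mono_mul_psum_pos_mem hy hz) ha
  have n1 : neg (mono r z) * pos (mono p x) ∈ depthTwoSeries := by
    rw [hfX]; exact sign_mul_mem_depthTwoSeries (pos_mono_mem hX) r
  have n2 : neg (mono r z) * pos (mono q y) ∈ depthTwoSeries := by
    rw [hgY]; exact sign_mul_mem_depthTwoSeries (pos_mono_mem hY) r
  have m7 := const_mul_mem_depthTwoSeries n1 hb
  have m8 := const_mul_mem_depthTwoSeries n2 ha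
  have m9 : neg (mono r z) * pos (mono p x) * psum (pos (mono q y)) ∈ depthTwoSeries := by
    rw [hfX]
    convert sign_mul_mem_depthTwoSeries (pos_mono_mul_psum_mem hy hX) r using 1
    funext n
    simp only [Pi.mul_apply]
    ring
  have m10 : neg (mono r z) * pos (mono q y) * psum (pos (mono p x)) ∈ depthTwoSeries := by
    rw [hgY]
    convert sign_mul_mem_depthTwoSeries (pos_mono_mul_psum_mem hx hY) r using 1
    funext n
    simp only [Pi.mul_apply]
    ring
  have m11 : neg (mono r z) * pos (mono p x) * pos (mono q y) ∈ depthTwoSeries := by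
    rw [hfX]
    have h2 : Nondeg (r + p + q) (X * y) :=
      Nondeg.of_two_le (by have := hX.one_le; have := hy.one_le; omega) (hX.fin.mul hy.fin)
    convert sign_mul_mem_depthTwoSeries (pos_mono_mem h2) r using 1
    rw [← pos_mono_mul]
    funext n
    simp only [Pi.mul_apply]
    ring
  -- Expanding the two products in Θ, with `psum` at n + 1 split as `psum` at n plus the term at n,
  -- leaves the two cross terms and `m1` to `m11`.
  have total := add_mem (sub_mem (sub_mem (sub_mem (sub_mem (sub_mem (sub_mem (sub_mem hΘ m1) m2) m3)
    m4) m9) m10) m11) (add_mem (add_mem (add_mem m5 m6) m7) m8)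
  convert total using 1
  funext n
  simp only [Pi.add_apply, Pi.sub_apply, Pi.mul_apply, psum_succ]
  ring

lemma psum_neg_mono_inv (p : ℕ) (x : ℂ) :
    psum (neg (mono p x⁻¹)) = fun n => (-1) ^ p * psum (pos (mono p x)) n := by
  rw [neg_mono, psum_sign_mul, inv_inv]

lemma psum_pos_mono_inv (p : ℕ) (x : ℂ) :
    psum (pos (mono p x⁻¹)) = fun n => (-1) ^ p * psum (neg (mono p x)) n := by
  have h : ((-1 : ℂ) ^ p) * (-1) ^ p = 1 := by rw [← mul_pow]; norm_num
  rw [neg_mono, psum_sign_mul]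
  funext n
  rw [← mul_assoc, h, one_mul]

/-- Replacing x and y by their inverses exchanges positive and negative partial sums, up to the sign
(-1)^(p+q). -/
lemma product_series_mem (hx : Nondeg p x) (hy : Nondeg q y) (hz : Nondeg r z) :
    pos (mono r z) * psum (pos (mono p x)) * psum (pos (mono q y))
      + neg (mono r z) * psum (neg (mono p x)) * psum (neg (mono q y)) ∈ depthTwoSeries := by
  convert sign_mul_mem_depthTwoSeries (cross_series_mem hx.inv hy.inv hz) (p + q) using 1
  have h : ∀ n, ((-1 : ℂ) ^ n) * (-1) ^ n = 1 := fun n => by rw [← mul_pow]; norm_num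
  rw [psum_neg_mono_inv, psum_neg_mono_inv, psum_pos_mono_inv, psum_pos_mono_inv]
  funext n
  simp only [Pi.add_apply, Pi.mul_apply]
  linear_combination (-(pos (mono r z) n * psum (pos (mono p x)) n * psum (pos (mono q y)) n
      + neg (mono r z) n * psum (neg (mono p x)) n * psum (neg (mono q y)) n)) * h (p + q)

/-- The parity theorem for cyclotomic multiple zeta values of depth three. -/
lemma parity_series_mem (hx : Nondeg p x) (hy : Nondeg q y) (hz : Nondeg r z) :
    pos (mono r z) * psum (pos (mono q y) * psum (pos (mono p x)))
      + neg (mono r z) * psum (neg (mono q y) * psum (neg (mono p x))) ∈ depthTwoSeries := by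
  -- Stuffle of a single with a double series. Besides the nested triple series it contains a
  -- product of two partial sums under the factor of y, removed by `h5`, and a merged term, removed
  -- by `h3` or `h4`.
  have h1 := mul_psum_add_mem_depthTwoSeries (pos_mono_mem hz) (pos_mono_mul_psum_mem hx hy)
  have h2 := mul_psum_add_mem_depthTwoSeries (neg_mono_mem hz) (neg_mono_mul_psum_mem hx hy)
  have hX : Nondeg (r + q) (z * y) :=
    Nondeg.of_two_le (by have := hz.one_le; have := hy.one_le; omega) (hz.fin.mul hy.fin)
  have h3 := pos_mono_mul_psum_mem hx hX
  have h4 := neg_mono_mul_psum_mem hx hX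
  have h5 := product_series_mem hx hz hy
  convert sub_mem (sub_mem (sub_mem (add_mem h1 h2) h5) h3) h4 using 1
  have e1 : pos (mono (r + q) (z * y)) = pos (mono r z) * pos (mono q y) :=
    (pos_mono_mul r q z y).symm
  have e2 : neg (mono (r + q) (z * y)) = neg (mono r z) * neg (mono q y) :=
    funext fun n => (mono_mul r q (-(n : ℤ))).symm
  rw [e1, e2]
  ring

end

/-! ### Parity conditions on the indices and S-values. -/

lemma psum_add_fun (f g : ℕ → ℂ) : psum (f + g) = psum f + psum g := funext fun n => psum_add f g n

lemma psum_sub_fun (f g : ℕ → ℂ) : psum (f - g) = psum f - psum g := by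
  funext n
  simp [psum, Finset.sum_sub_distrib]

/-- Twice the restriction of `mono a X` to the even integers. -/
noncomputable def evenMono (a : ℕ) (X : ℂ) : ℤ → ℂ := mono a X + mono a (-X)

/-- Twice the restriction of `mono a X` to the odd integers. -/
noncomputable def oddMono (a : ℕ) (X : ℂ) : ℤ → ℂ := mono a X - mono a (-X)

/-- Multilinearity gives eight instances of the parity theorem, with a minus sign for those at -w.
-/
lemma parity_even_odd_even_mem {p q r : ℕ} {u w v : ℂ} (hu : Nondeg p u) (hu' : Nondeg p (-u))
    (hw : Nondeg q w) (hw' : Nondeg q (-w)) (hv : Nondeg r v) (hv' : Nondeg r (-v)) :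
    pos (evenMono r v) * psum (pos (oddMono q w) * psum (pos (evenMono p u)))
      + neg (evenMono r v) * psum (neg (oddMono q w) * psum (neg (evenMono p u)))
        ∈ depthTwoSeries := by
  have total := sub_mem
    (add_mem (add_mem (parity_series_mem hu hw hv) (parity_series_mem hu hw hv'))
      (add_mem (parity_series_mem hu' hw hv) (parity_series_mem hu' hw hv')))
    (add_mem (add_mem (parity_series_mem hu hw' hv) (parity_series_mem hu hw' hv'))
      (add_mem (parity_series_mem hu' hw' hv) (parity_series_mem hu' hw' hv')))
  convert total using 1
  have e1 : ∀ a X, pos (evenMono a X) = pos (mono a X) + pos (mono a (-X)) := fun _ _ => rfl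
  have e2 : ∀ a X, neg (evenMono a X) = neg (mono a X) + neg (mono a (-X)) := fun _ _ => rfl
  have e3 : ∀ a X, pos (oddMono a X) = pos (mono a X) - pos (mono a (-X)) := fun _ _ => rfl
  have e4 : ∀ a X, neg (oddMono a X) = neg (mono a X) - neg (mono a (-X)) := fun _ _ => rfl
  simp only [e1, e2, e3, e4, psum_add_fun, psum_sub_fun, mul_add, sub_mul]
  ring

lemma pos_evenMono_even (a : ℕ) (X : ℂ) (n : ℕ) :
    pos (evenMono a X) (2 * n) = 2 * ((X ^ 2) ^ n / (2 * (n : ℂ)) ^ a) := by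
  have : pos (evenMono a X) (2 * n) = pos (mono a X) (2 * n) + pos (mono a (-X)) (2 * n) := rfl
  rw [this, pos_mono, pos_mono, (even_two_mul n).neg_pow, pow_mul]
  push_cast
  ring

lemma pos_evenMono_odd (a : ℕ) (X : ℂ) (n : ℕ) : pos (evenMono a X) (2 * n + 1) = 0 := by
  have : pos (evenMono a X) (2 * n + 1)
      = pos (mono a X) (2 * n + 1) + pos (mono a (-X)) (2 * n + 1) := rfl
  rw [this, pos_mono, pos_mono, (odd_two_mul_add_one n).neg_pow]
  ring

lemma pos_oddMono_even (a : ℕ) (X : ℂ) (n : ℕ) : pos (oddMono a X) (2 * n) = 0 := by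
  have : pos (oddMono a X) (2 * n) = pos (mono a X) (2 * n) - pos (mono a (-X)) (2 * n) := rfl
  rw [this, pos_mono, pos_mono, (even_two_mul n).neg_pow]
  ring

lemma pos_oddMono_odd (a : ℕ) {X : ℂ} (hX : X ≠ 0) (n : ℕ) :
    pos (oddMono a X) (2 * n + 1)
      = 2 * X⁻¹ * ((X ^ 2) ^ (n + 1) / (2 * ((n + 1 : ℕ) : ℂ) - 1) ^ a) := by
  have : pos (oddMono a X) (2 * n + 1)
      = pos (mono a X) (2 * n + 1) - pos (mono a (-X)) (2 * n + 1) := rfl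
  rw [this, pos_mono, pos_mono, (odd_two_mul_add_one n).neg_pow, ← pow_mul,
    show 2 * (n + 1) = (2 * n + 1) + 1 by ring, pow_succ X (2 * n + 1)]
  push_cast
  rw [show 2 * ((n : ℂ) + 1) - 1 = 2 * n + 1 by ring]
  field_simp
  ring

lemma psum_of_even {E F : ℕ → ℂ} {c : ℂ} (h0 : ∀ n, E (2 * n) = c * F n)
    (h1 : ∀ n, E (2 * n + 1) = 0) (n : ℕ) : psum E (2 * n) = c * psum F n := by
  induction n with
  | zero => simp [psum_zero]
  | succ n ih => rw [mul_add_one, psum_succ, psum_succ, psum_succ, ih, h0, h1]; ring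

lemma psum_of_odd {E F : ℕ → ℂ} {c : ℂ} (h0 : ∀ n, E (2 * n) = 0)
    (h1 : ∀ n, E (2 * n + 1) = c * F n) (n : ℕ) : psum E (2 * n) = c * psum F n := by
  induction n with
  | zero => simp [psum_zero]
  | succ n ih => rw [mul_add_one, psum_succ, psum_succ, psum_succ, ih, h0, h1]; ring

lemma psum_shift {F : ℕ → ℂ} (h : F 0 = 0) (n : ℕ) : psum (fun n => F (n + 1)) n = psum F (n + 1) := by
  rw [psum, psum, Finset.sum_range_succ', h, add_zero]

/-- The indices 2n₁ < 2n₂-1 < 2n₃-2 of the right side carry u^(2n₁), w^(2n₂-1), v^(2n₃-2), which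
explains the factor v²w. The three doubled monomials supply 2³, and n₃ ≤ M means 2n₃-2 < 2M. -/
lemma multipleSPartial_eq_psum {p : ℕ} (hp : 1 ≤ p) (q r : ℕ) {u w v : ℂ} (hw : w ≠ 0)
    (hv : v ≠ 0) (M : ℕ) : multipleSPartial ![p, q, r] ![u ^ 2, w ^ 2, v ^ 2] M
      = v ^ 2 * w * psum (pos (evenMono r v) * psum (pos (oddMono q w) * psum (pos (evenMono p u))))
        (2 * M) := by
  set F : ℕ → ℂ := fun n => (u ^ 2) ^ n / (2 * (n : ℂ)) ^ p with hF
  set G : ℕ → ℂ := fun n => (w ^ 2) ^ n / (2 * (n : ℂ) - 1) ^ q with hG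
  set H : ℕ → ℂ := fun n => (v ^ 2) ^ n / (2 * (n : ℂ) - 2) ^ r with hH
  have hS : multipleSPartial ![p, q, r] ![u ^ 2, w ^ 2, v ^ 2] M
      = 2 ^ 3 * psum (H * psum (G * psum F)) (M + 1) := by
    rw [multipleSPartial, sum_increasingTuples_three (fun i n => ![u ^ 2, w ^ 2, v ^ 2] i ^ n /
      (2 * (n : ℂ) - ((i : ℕ) : ℂ)) ^ (![p, q, r] i))]
    · simp [hF, hG, hH]
    · simp [show p ≠ 0 by omega]
  have h1 : ∀ n, psum (pos (evenMono p u)) (2 * n) = 2 * psum F n :=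
    psum_of_even (pos_evenMono_even p u) (pos_evenMono_odd p u)
  have h2 : ∀ n, psum (pos (oddMono q w) * psum (pos (evenMono p u))) (2 * n)
      = 4 * w⁻¹ * psum (G * psum F) (n + 1) := fun n => by
    rw [← psum_shift (by simp [psum_zero])]
    refine psum_of_odd (fun n => ?_) (fun n => ?_) n
    · rw [Pi.mul_apply, pos_oddMono_even, zero_mul]
    · have h1' := h1 (n + 1)
      rw [mul_add_one, psum_succ, pos_evenMono_odd, add_zero] at h1'
      rw [Pi.mul_apply, pos_oddMono_odd q hw, h1', Pi.mul_apply]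
      ring
  have h3 : psum (pos (evenMono r v) * psum (pos (oddMono q w) * psum (pos (evenMono p u)))) (2 * M)
      = 8 * w⁻¹ * (v ^ 2)⁻¹ * psum (H * psum (G * psum F)) (M + 1) := by
    rw [← psum_shift (by simp [psum_zero])]
    refine psum_of_even (fun n => ?_) (fun n => ?_) M
    · rw [Pi.mul_apply, pos_evenMono_even, h2, Pi.mul_apply, hH]
      simp only [pow_succ (v ^ 2) n]
      push_cast
      rw [show 2 * ((n : ℂ) + 1) - 2 = 2 * n by ring]
      field_simp
      ring
    · rw [Pi.mul_apply, pos_evenMono_odd, zero_mul]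
  rw [hS, h3]
  field_simp
  ring

lemma nondeg_of_sq {a : ℕ} {X u : ℂ} (ha : 1 ≤ a) (hX : IsOfFinOrder X) (hne : (a, X) ≠ (1, 1))
    (hu : u ^ 2 = X) : Nondeg a u := by
  refine ⟨ha, ?_, fun h => hne ?_⟩
  · obtain ⟨n, hn, h1⟩ := isOfFinOrder_iff_pow_eq_one.1 hX
    exact isOfFinOrder_iff_pow_eq_one.2 ⟨2 * n, by omega, by rw [pow_mul, hu, h1]⟩
  · obtain ⟨rfl, rfl⟩ := Prod.mk.inj h
    simp [← hu]

lemma exists_tendsto_multipleSPartial {p q r : ℕ} {u w v : ℂ} (hu : Nondeg p u)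
    (hu' : Nondeg p (-u)) (hw : Nondeg q w) (hw' : Nondeg q (-w)) (hv : Nondeg r v)
    (hv' : Nondeg r (-v)) :
    ∃ L, TameSum (pos (evenMono r v) * psum (pos (oddMono q w) * psum (pos (evenMono p u)))) L ∧
      Tendsto (multipleSPartial ![p, q, r] ![u ^ 2, w ^ 2, v ^ 2]) atTop (𝓝 (v ^ 2 * w * L)) := by
  have hE : ∃ L, TameSum (pos (evenMono p u)) L :=
    exists_tameSum_of_mem (add_mem (pos_mono_mem hu) (pos_mono_mem hu'))
  have hO : ∃ L, TameSum (pos (oddMono q w)) L :=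
    exists_tameSum_of_mem (sub_mem (pos_mono_mem hw) (pos_mono_mem hw'))
  have hE' : ∃ L, TameSum (pos (evenMono r v)) L :=
    exists_tameSum_of_mem (add_mem (pos_mono_mem hv) (pos_mono_mem hv'))
  obtain ⟨L, hL⟩ := exists_tameSum_mul_psum hE' (exists_tameSum_mul_psum hO hE)
  refine ⟨L, hL, ?_⟩
  have h2 : Tendsto (fun M : ℕ => 2 * M) atTop atTop :=
    tendsto_id.const_mul_atTop' (by norm_num)
  refine ((hL.tendsto.comp h2).const_mul (v ^ 2 * w)).congr fun M => ?_
  rw [multipleSPartial_eq_psum hu.one_le q r hw.ne_zero hv.ne_zero M]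
  rfl

lemma neg_evenMono (a : ℕ) (X : ℂ) :
    neg (evenMono a X) = fun n => (-1) ^ a * pos (evenMono a X⁻¹) n := by
  funext n
  have : neg (evenMono a X) n = mono a X (-n) + mono a (-X) (-n) := rfl
  rw [this, mono_neg, mono_neg, inv_neg, ← mul_add]
  rfl

lemma neg_oddMono (a : ℕ) (X : ℂ) :
    neg (oddMono a X) = fun n => (-1) ^ a * pos (oddMono a X⁻¹) n := by
  funext n
  have : neg (oddMono a X) n = mono a X (-n) - mono a (-X) (-n) := rfl
  rw [this, mono_neg, mono_neg, inv_neg, ← mul_sub]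
  rfl

theorem mainTheorem8 (p q r : ℕ) (hp : 1 ≤ p) (hq : 1 ≤ q) (hr : 1 ≤ r)
    (x y z : ℂ) (hx : IsOfFinOrder x) (hy : IsOfFinOrder y) (hz : IsOfFinOrder z)
    (hpx : (p, x) ≠ (1, 1)) (hqy : (q, y) ≠ (1, 1)) (hrz : (r, z) ≠ (1, 1))
    (w : ℂ) (hw : w ^ 2 = y) :
    Tendsto (multipleSPartial ![p, q, r] ![x, y, z]) atTop
        (𝓝 (multipleS ![p, q, r] ![x, y, z])) ∧
      Tendsto (multipleSPartial ![p, q, r] ![x⁻¹, y⁻¹, z⁻¹]) atTop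
        (𝓝 (multipleS ![p, q, r] ![x⁻¹, y⁻¹, z⁻¹])) ∧
      ∃ P ∈ rationalCombinationsOfProducts 2,
        multipleS ![p, q, r] ![x, y, z]
          + (-1) ^ (p + q + r) * y * z ^ 2 * multipleS ![p, q, r] ![x⁻¹, y⁻¹, z⁻¹]
          = z * w * P := by
  obtain ⟨u, hu⟩ := IsAlgClosed.exists_pow_nat_eq x (n := 2) (by norm_num)
  obtain ⟨v, hv⟩ := IsAlgClosed.exists_pow_nat_eq z (n := 2) (by norm_num)
  have nu := nondeg_of_sq hp hx hpx hu
  have nu' := nondeg_of_sq (u := -u) hp hx hpx (by rw [neg_sq, hu])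
  have nw := nondeg_of_sq hq hy hqy hw
  have nw' := nondeg_of_sq (u := -w) hq hy hqy (by rw [neg_sq, hw])
  have nv := nondeg_of_sq hr hz hrz hv
  have nv' := nondeg_of_sq (u := -v) hr hz hrz (by rw [neg_sq, hv])
  obtain ⟨L, hL, hS⟩ := exists_tendsto_multipleSPartial nu nu' nw nw' nv nv'
  obtain ⟨K, hK, hT⟩ := exists_tendsto_multipleSPartial (u := u⁻¹) (w := w⁻¹) (v := v⁻¹) nu.inv
    (by simpa [inv_neg] using nu'.inv) nw.inv (by simpa [inv_neg] using nw'.inv) nv.inv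
    (by simpa [inv_neg] using nv'.inv)
  obtain ⟨P, hP, hPL⟩ := parity_even_odd_even_mem nu nu' nw nw' nv nv'
  have hneg : neg (evenMono r v) * psum (neg (oddMono q w) * psum (neg (evenMono p u)))
      = fun n => (-1) ^ (p + q + r) * (pos (evenMono r v⁻¹) *
        psum (pos (oddMono q w⁻¹) * psum (pos (evenMono p u⁻¹)))) n := by
    rw [neg_evenMono, neg_evenMono, neg_oddMono, psum_sign_mul]
    have : ((fun n => (-1) ^ q * pos (oddMono q w⁻¹) n) *
        fun n => (-1) ^ p * psum (pos (evenMono p u⁻¹)) n)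
        = fun n => (-1) ^ (p + q) * (pos (oddMono q w⁻¹) * psum (pos (evenMono p u⁻¹))) n := by
      funext n
      simp only [Pi.mul_apply]
      ring
    rw [this, psum_sign_mul]
    funext n
    simp only [Pi.mul_apply]
    ring
  rw [hneg] at hPL
  have hPeq : P = L + (-1) ^ (p + q + r) * K := hPL.unique (hL.add (hK.const_mul _))
  simp only [inv_pow] at hT
  rw [hu, hw, hv] at hS hT
  have eS : multipleS ![p, q, r] ![x, y, z] = z * w * L := hS.limUnder_eq
  have eT : multipleS ![p, q, r] ![x⁻¹, y⁻¹, z⁻¹] = z⁻¹ * w⁻¹ * K := hT.limUnder_eq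
  refine ⟨eS ▸ hS, eT ▸ hT, P, hP, ?_⟩
  have hw0 := nw.ne_zero
  have hz0 := ne_zero_of_isOfFinOrder hz
  -- The prefactors match because y z² · z⁻¹ w⁻¹ = z w when y = w².
  rw [eS, eT, hPeq, ← hw]
  field_simp
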